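/- Setting. Let $N,K\ge 1$ and $F$ be integers, $M,R\ge 0$ real. A server holds $N$ independent files $W_0,\dots,W_{N-1}$, each uniform on $\{0,1\}^F$; write $\bar W=(W_0,\dots,W_{N-1})$. Users $0,\dots,K-1$ have a demand vector $\bar D=(D_0,\dots,D_{K-1})$ uniform on $\{0,\dots,N-1\}^K$. There are shared randomness $\bar S=(S_0,\dots,S_{K-1})$ ($S_k$ is known to user $k$ and to the server; the $S_k$ take finitely many values and may be mutually dependent) and private randomness $P$ of the server (a discrete random variable); $\bar W,\bar D,\bar S,P$ are independent. A scheme consists of cache encoders $C_k(S_k,P,\bar W)$, a main payload $E(\bar W,\bar D,P,\bar S)$, an auxiliary transmission $J(\bar D,P,\bar S)$, each with values in a finite alphabet, and decoders $G_k$. With $Z_k=(C_k,S_k)$ and $X=(E,J)$ it is a demand-private scheme if, for every user $k$, $$G_k(D_k,S_k,J,E,C_k)=W_{D_k}\ \text{ with probability one},\qquad I\big((D_i)_{i\ne k};\,Z_k,X,D_k\big)=0 .$$ For an alphabet $\mathcal A$ let $\mathrm{len}=\log_2|\mathcal A|$. The pair $(M,R)$ is achievable with demand privacy for $(N,K)$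 if there are demand-private schemes with file sizes $F\to\infty$ such that $\mathrm{len}(C_k)\le MF+o(F)$ and $\mathrm{len}(S_k)=o(F)$ for all $k$, $\mathrm{len}(E)\le RF+o(F)$, and $\mathrm{len}(J)=o(F)$. Theorem. Let $M,R\ge 0$. 1. $(M,R)$ is achievable with demand privacy for $N=K=2$ if and only if $$2M+R\ge 2,\qquad 3M+3R\ge 5,\qquad M+2R\ge 2 .$$ 2. For every $N>2$, $(M,R)$ is achievable with demand privacy for $N$ files and $K=2$ users if and only if $$3M+NR\ge 2N,\qquad 3M+(N+1)R\ge 2N+1,\qquad M+NR\ge N .$$ -/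

import Mathlib

noncomputable section

namespace CodedCaching

/-- Shannon entropy (in bits) of a law `p` on a finite alphabet. -/
def entropy {A : Type} [Fintype A] (p : PMF A) : ℝ :=
  ∑ a, Real.negMulLog (p a).toReal / Real.log 2

/-- Mutual information `I(A; B) = H(A) + H(B) - H(A, B)` (in bits) of a pair of random variables
on finite alphabets, given their joint law. -/
def mutualInfo {A B : Type} [Fintype A] [Fintype B] (p : PMF (A × B)) : ℝ :=
  entropy (p.map Prod.fst) + entropy (p.map Prod.snd) - entropy p

/-- `len A = log₂ |A|`, the size in bits of a finite alphabet. -/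
def len (A : Type) [Fintype A] : ℝ := Real.logb 2 (Fintype.card A)

/-- The values of the `N` files, each a string of `F` bits. -/
abbrev Files (N F : ℕ) : Type := Fin N → Fin F → Bool

/-- The demand vectors of `K` users, each demanding one of `N` files. -/
abbrev Demands (N K : ℕ) : Type := Fin K → Fin N

/-- The demands of all users other than user `k`. -/
abbrev OtherDemands (N K : ℕ) (k : Fin K) : Type := {i : Fin K // i ≠ k} → Fin N

/-- The data of a coded caching scheme with `N` files of `F` bits and `K` users, where the server
shares randomness `S k` with user `k` and has private randomness `P`. -/
structure Scheme (N K F : ℕ) where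
  /-- alphabet of the randomness shared with user `k` -/
  S : Fin K → Type
  [fintypeS : ∀ k, Fintype (S k)]
  /-- alphabet of the private randomness of the server -/
  P : Type
  /-- alphabet of the auxiliary transmission -/
  J : Type
  [fintypeJ : Fintype J]
  /-- size of the alphabet of the main part of each cache -/
  cacheSize : ℕ
  /-- size of the alphabet of the main payload of the broadcast -/
  payloadSize : ℕ
  /-- joint law of the shared randomness `(S 0, …, S (K-1))`; the components may be dependent -/
  lawS : PMF (∀ k, S k)
  /-- law of the private randomness -/
  lawP : PMF P
  /-- cache encoding functions -/
  cache : ∀ k, S k → P → Files N F → Fin cacheSize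
  /-- encoding function of the main payload -/
  payload : Files N F → Demands N K → P → (∀ k, S k) → Fin payloadSize
  /-- encoding function of the auxiliary transmission; it does not see the files -/
  aux : Demands N K → P → (∀ k, S k) → J
  /-- decoding functions -/
  decode : ∀ k, Fin N → S k → J → Fin payloadSize → Fin cacheSize → (Fin F → Bool)

attribute [instance] Scheme.fintypeS Scheme.fintypeJ

namespace Scheme

variable {N K F : ℕ}

/-- The joint law of the files, the demand vector, the private randomness and the shared
randomness: these four are independent, the files and the demand vector being uniform. -/
def law [NeZero N] (c : Scheme N K F) :
    PMF (Files N F × Demands N K × c.P × (∀ k, c.S k)) :=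
  (PMF.uniformOfFintype (Files N F)).bind fun w =>
    (PMF.uniformOfFintype (Demands N K)).bind fun d =>
      c.lawP.bind fun p =>
        c.lawS.bind fun s => PMF.pure (w, d, p, s)

/-- The alphabet of everything user `k` sees: her demand, her shared randomness, the auxiliary
transmission, the main payload, and the main part of her cache. -/
abbrev View (c : Scheme N K F) (k : Fin K) : Type :=
  Fin N × c.S k × c.J × Fin c.payloadSize × Fin c.cacheSize

/-- What user `k` sees, as a function of the underlying random variables. -/
def view (c : Scheme N K F) (k : Fin K) (w : Files N F) (d : Demands N K) (p : c.P)
    (s : ∀ k, c.S k) : c.View k :=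
  (d k, s k, c.aux d p s, c.payload w d p s, c.cache k (s k) p w)

/-- Zero-error decoding: with probability one, every user recovers her demanded file. -/
def IsDecodable (c : Scheme N K F) : Prop :=
  ∀ k, ∀ w d, ∀ p ∈ c.lawP.support, ∀ s ∈ c.lawS.support,
    c.decode k (d k) (s k) (c.aux d p s) (c.payload w d p s) (c.cache k (s k) p w) = w (d k)

/-- Perfect demand privacy: for every user, the demands of the other users have zero mutual
information with everything she sees. -/
def IsDemandPrivate [NeZero N] (c : Scheme N K F) : Prop :=
  ∀ k, mutualInfo (c.law.map fun ω =>
    ((fun i => ω.2.1 i.1 : OtherDemands N K k), c.view k ω.1 ω.2.1 ω.2.2.1 ω.2.2.2)) = 0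

end Scheme

/-- `(M, R)` is achievable with demand privacy for `N` files and `K` users: there are decodable
and demand-private schemes of arbitrarily large file size `F` whose caches have `M F + o(F)` bits
and whose broadcasts have `R F + o(F)` bits (at most), the sizes of the shared randomness and of
the auxiliary transmission being `o(F)`. -/
def Achievable (N K : ℕ) [NeZero N] (M R : ℝ) : Prop :=
  ∀ ε : ℝ, 0 < ε → ∀ F₀ : ℕ, ∃ F : ℕ, F₀ ≤ F ∧ ∃ c : Scheme N K F,
    c.IsDecodable ∧ c.IsDemandPrivate ∧
    len (Fin c.cacheSize) ≤ (M + ε) * F ∧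
    len (Fin c.payloadSize) ≤ (R + ε) * F ∧
    (∀ k, len (c.S k) ≤ ε * F) ∧
    len c.J ≤ ε * F

end CodedCaching

end

/-! Converse. Write Z_k for what user k holds, X_d for the broadcast under demands d, and W_{<j} for
the first j files. Decodability says that (Z_k, X_d) determines file d k, and the bounds follow from
submodularity of entropy applied to caches, broadcasts and initial blocks of files. The basic move,
iterated in `IsDecodable.chain`, spends one broadcast to add a file both to H(Z_k, W_{<j}) and to
H(Z_0, Z_1, W_{<i}), where j < i. Privacy is used only in `IsDecodable.private_bound`: user 1 cannot
tell whether user 0 shares her demand, so (X_d, W_0) has the same entropy for the demands (0, 0) and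
(N-1, 0), and one broadcast may replace the other. The remaining bounds need decodability alone.

Achievability. The lower boundary of each region is polygonal with four corners, so by memory
sharing a linear scheme over 𝔽₂ for each corner suffices. Such a scheme becomes private by
conjugating it with secret random automorphisms of the symbol, cache and payload spaces, and sending
each user her conjugated decoder under a one-time pad. Fix a user and her demand. If the ranges of
the two halves of her decoder do not depend on the other demand, up to a common automorphism of the
symbol space, and if (cache, payload) is onto, then a change of the other demand is compensated by a
bijection of files and randomness that preserves her view (`LinearScheme.exists_equivs`). Decoders
are reused for all symbols of a file, so pads and auxiliary transmission have bounded size and cost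
o(F). -/

noncomputable section

namespace CodedCaching

set_option linter.unusedSectionVars false

/-! ### Log-sum inequalities and their equality case -/

/-- The sum comparison behind all Shannon inequalities: one term of the relative entropy between a
joint law and the conditional product of its marginals. -/
lemma sub_mul_div_le_mul_log {q α β t : ℝ} (hq : 0 ≤ q) (hα : q ≤ α) (hβ : q ≤ β) (ht : q ≤ t) :
    q - α * β / t ≤ q * (Real.log q + Real.log t - Real.log α - Real.log β) := by
  rcases hq.eq_or_lt with rfl | hq
  · simp; positivity
  have h1 : 0 < α := by linarith
  have h2 : 0 < β := by linarith
  have h3 : 0 < t := by linarith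
  -- Everything comes from log x ≤ x - 1 at the likelihood ratio x = αβ / (qt).
  have := Real.log_le_sub_one_of_pos (x := α * β / (q * t)) (by positivity)
  rw [Real.log_div (by positivity) (by positivity), Real.log_mul h1.ne' h2.ne',
    Real.log_mul hq.ne' h3.ne'] at this
  have h4 := mul_le_mul_of_nonneg_left this hq.le
  have h5 : q * (α * β / (q * t) - 1) = α * β / t - q := by field_simp
  nlinarith

/-- Equality case for total mass t = 1: log x < x - 1 unless x = 1. -/
lemma eq_mul_of_mul_log_le {q α β : ℝ} (hq : 0 ≤ q) (hα : q ≤ α) (hβ : q ≤ β)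
    (h : q * (Real.log q - Real.log α - Real.log β) ≤ q - α * β) : q = α * β := by
  rcases hq.eq_or_lt with rfl | hq
  · have : 0 ≤ α * β := mul_nonneg hα hβ
    simp at h; linarith
  have h1 : 0 < α := by linarith
  have h2 : 0 < β := by linarith
  by_contra hne
  have h3 : α * β / q ≠ 1 := by
    intro h'
    rw [div_eq_one_iff_eq hq.ne'] at h'
    exact hne h'.symm
  have := Real.log_lt_sub_one_of_pos (x := α * β / q) (by positivity) h3
  rw [Real.log_div (by positivity) (by positivity), Real.log_mul h1.ne' h2.ne'] at this
  have h4 := mul_lt_mul_of_pos_left this hq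
  have h5 : q * (α * β / q - 1) = α * β - q := by field_simp
  nlinarith

section Sums

variable {A B C : Type} [Fintype A] [Fintype B] [Fintype C]

lemma mul_log_sum_eq (q : A → B → ℝ) :
    (∑ a, ∑ b, q a b * (Real.log (q a b) + Real.log (∑ a, ∑ b, q a b)
        - Real.log (∑ b, q a b) - Real.log (∑ a, q a b)))
      = ∑ a, Real.negMulLog (∑ b, q a b) + ∑ b, Real.negMulLog (∑ a, q a b)
        - ∑ a, ∑ b, Real.negMulLog (q a b) - Real.negMulLog (∑ a, ∑ b, q a b) := by
  have e1 : ∑ b, Real.negMulLog (∑ a, q a b) = ∑ a, ∑ b, -(q a b * Real.log (∑ a, q a b)) := by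
    rw [Finset.sum_comm]
    refine Finset.sum_congr rfl fun b _ => ?_
    rw [Real.negMulLog, neg_mul, Finset.sum_mul, Finset.sum_neg_distrib]
  have e2 : ∑ a, Real.negMulLog (∑ b, q a b) = ∑ a, ∑ b, -(q a b * Real.log (∑ b, q a b)) := by
    refine Finset.sum_congr rfl fun b _ => ?_
    rw [Real.negMulLog, neg_mul, Finset.sum_mul, Finset.sum_neg_distrib]
  have e3 : Real.negMulLog (∑ a, ∑ b, q a b)
      = ∑ a, ∑ b, -(q a b * Real.log (∑ a, ∑ b, q a b)) := by
    rw [Real.negMulLog, neg_mul, Finset.sum_mul]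
    simp_rw [Finset.sum_neg_distrib, Finset.sum_mul]
  rw [e1, e2, e3]
  simp_rw [← Finset.sum_add_distrib, ← Finset.sum_sub_distrib]
  refine Finset.sum_congr rfl fun a _ => Finset.sum_congr rfl fun b _ => ?_
  rw [Real.negMulLog]; ring

lemma sum_sum_mul_div (q : A → B → ℝ) :
    ∑ a, ∑ b, (∑ b, q a b) * (∑ a, q a b) / (∑ a, ∑ b, q a b) = ∑ a, ∑ b, q a b := by
  simp_rw [← Finset.sum_div, ← Finset.mul_sum]
  rw [Finset.sum_comm (f := fun b a => q a b), ← Finset.sum_mul]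
  by_cases h : (∑ a, ∑ b, q a b) = 0
  · simp [h]
  · field_simp

variable {q : A → B → ℝ}

lemma le_row_sum (hq : ∀ a b, 0 ≤ q a b) (a : A) (b : B) : q a b ≤ ∑ b, q a b :=
  Finset.single_le_sum (f := fun b => q a b) (fun b _ => hq a b) (Finset.mem_univ b)

lemma le_col_sum (hq : ∀ a b, 0 ≤ q a b) (a : A) (b : B) : q a b ≤ ∑ a, q a b :=
  Finset.single_le_sum (f := fun a => q a b) (fun a _ => hq a b) (Finset.mem_univ a)

lemma le_total_sum (hq : ∀ a b, 0 ≤ q a b) (a : A) (b : B) : q a b ≤ ∑ a, ∑ b, q a b :=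
  (le_row_sum hq a b).trans (Finset.single_le_sum (f := fun a => ∑ b, q a b)
    (fun a _ => Finset.sum_nonneg fun b _ => hq a b) (Finset.mem_univ a))

/-- The total mass is left arbitrary so that the inequality applies to slices of a joint law, where
it becomes a conditional statement. -/
lemma negMulLog_sum_submodular (hq : ∀ a b, 0 ≤ q a b) :
    ∑ a, ∑ b, Real.negMulLog (q a b) + Real.negMulLog (∑ a, ∑ b, q a b)
      ≤ ∑ a, Real.negMulLog (∑ b, q a b) + ∑ b, Real.negMulLog (∑ a, q a b) := by
  have h := Finset.sum_le_sum fun a (_ : a ∈ Finset.univ) =>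
    Finset.sum_le_sum fun b (_ : b ∈ Finset.univ) =>
      sub_mul_div_le_mul_log (hq a b) (le_row_sum hq a b) (le_col_sum hq a b) (le_total_sum hq a b)
  rw [mul_log_sum_eq] at h
  simp_rw [Finset.sum_sub_distrib] at h
  rw [sum_sum_mul_div] at h
  linarith

/-- The entropy gap is a sum of nonnegative terms, so it vanishes only if each term does, and each
vanishing term forces the product form. -/
lemma eq_mul_of_negMulLog_sum_eq (hq : ∀ a b, 0 ≤ q a b) (h1 : ∑ a, ∑ b, q a b = 1)
    (h : ∑ a, Real.negMulLog (∑ b, q a b) + ∑ b, Real.negMulLog (∑ a, q a b)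
      = ∑ a, ∑ b, Real.negMulLog (q a b)) (a : A) (b : B) :
    q a b = (∑ b, q a b) * ∑ a, q a b := by
  have key : ∀ a b, q a b - (∑ b, q a b) * (∑ a, q a b) / (∑ a, ∑ b, q a b) ≤ _ := fun a b =>
    sub_mul_div_le_mul_log (hq a b) (le_row_sum hq a b) (le_col_sum hq a b) (le_total_sum hq a b)
  have hs : ∑ a, ∑ b, (q a b * (Real.log (q a b) + Real.log (∑ a, ∑ b, q a b)
        - Real.log (∑ b, q a b) - Real.log (∑ a, q a b))
        - (q a b - (∑ b, q a b) * (∑ a, q a b) / (∑ a, ∑ b, q a b))) = 0 := by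
    simp_rw [Finset.sum_sub_distrib]
    rw [sum_sum_mul_div, sub_self, sub_zero]
    have := mul_log_sum_eq q
    rw [this, h, h1]; simp
  have h2 := (Finset.sum_eq_zero_iff_of_nonneg (fun a _ => Finset.sum_nonneg fun b _ =>
    sub_nonneg.2 (key a b))).1 hs a (Finset.mem_univ a)
  have h3 := (Finset.sum_eq_zero_iff_of_nonneg (fun b _ =>
    sub_nonneg.2 (key a b))).1 h2 b (Finset.mem_univ b)
  rw [h1] at h3
  refine eq_mul_of_mul_log_le (hq a b) (le_row_sum hq a b) (le_col_sum hq a b) ?_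
  simp only [Real.log_one, div_one, add_zero] at h3
  linarith

end Sums

/-! ### Entropy calculus for random variables -/

section Entropy

variable {Ω A B C D : Type} [Fintype A] [Fintype B] [Fintype C] [Fintype D] (μ : PMF Ω)

/-- The probability that `f = a`. -/
def prob (f : Ω → A) (a : A) : ℝ := ((μ.map f) a).toReal

/-- The Shannon entropy of the random variable `f`, in nats. -/
def ent (f : Ω → A) : ℝ := ∑ a, Real.negMulLog (prob μ f a)

/-- The value of `f` almost surely determines the value of `g`. -/
def Det {A B : Type} (f : Ω → A) (g : Ω → B) : Prop :=
  ∀ ω ∈ μ.support, ∀ ω' ∈ μ.support, f ω = f ω' → g ω = g ω'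

variable {μ}

lemma prob_nonneg (f : Ω → A) (a : A) : 0 ≤ prob μ f a := ENNReal.toReal_nonneg

lemma sum_toReal_eq_one (p : PMF A) : ∑ a, (p a).toReal = 1 := by
  rw [← ENNReal.toReal_sum fun a _ => p.apply_ne_top a, ← tsum_fintype (L := .unconditional A), p.tsum_coe]; rfl

lemma sum_prob (f : Ω → A) : ∑ a, prob μ f a = 1 := sum_toReal_eq_one _

open scoped Classical in
lemma toReal_map_apply (p : PMF A) (φ : A → B) (b : B) :
    ((p.map φ) b).toReal = ∑ a, if b = φ a then (p a).toReal else 0 := by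
  rw [PMF.map_apply, tsum_fintype, ENNReal.toReal_sum]
  · exact Finset.sum_congr rfl fun a _ => by split_ifs <;> rfl
  · intro a _; split_ifs
    · exact p.apply_ne_top a
    · exact ENNReal.zero_ne_top

open scoped Classical in
lemma prob_comp (f : Ω → A) (φ : A → B) (b : B) :
    prob μ (φ ∘ f) b = ∑ a, if b = φ a then prob μ f a else 0 := by
  unfold prob
  rw [← PMF.map_comp, toReal_map_apply]

lemma map_congr_of_support {f g : Ω → A} (h : ∀ ω ∈ μ.support, f ω = g ω) :
    μ.map f = μ.map g := by
  classical
  ext a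
  rw [PMF.map_apply, PMF.map_apply]
  refine tsum_congr fun ω => ?_
  by_cases hω : ω ∈ μ.support
  · rw [h ω hω]
  · have : μ ω = 0 := by simpa [PMF.mem_support_iff] using hω
    simp [this]

/-- Merging values increases probabilities, and -log is decreasing. -/
lemma ent_comp_le (f : Ω → A) (φ : A → B) : ent μ (φ ∘ f) ≤ ent μ f := by
  classical
  unfold ent
  have e : ∑ a, Real.negMulLog (prob μ f a)
      = ∑ b, ∑ a, if b = φ a then Real.negMulLog (prob μ f a) else 0 := by
    rw [Finset.sum_comm]; simp
  rw [e]
  refine Finset.sum_le_sum fun b _ => ?_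
  conv_lhs => rw [Real.negMulLog, neg_mul]
  conv_lhs => rw [prob_comp, Finset.sum_mul, ← Finset.sum_neg_distrib]
  refine Finset.sum_le_sum fun a _ => ?_
  split_ifs with hb
  · rw [Real.negMulLog, neg_mul, neg_le_neg_iff]
    rcases (prob_nonneg (μ := μ) f a).eq_or_lt with h | h
    · simp [← h]
    · refine mul_le_mul_of_nonneg_left (Real.log_le_log h ?_) h.le
      have := Finset.single_le_sum (f := fun a => if b = φ a then prob μ f a else 0)
        (fun a _ => by positivity [prob_nonneg (μ := μ) f a]) (Finset.mem_univ a)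
      simpa [hb] using this
  · simp

lemma ent_le_of_det {f : Ω → A} {g : Ω → B} (h : Det μ f g) : ent μ g ≤ ent μ f := by
  classical
  obtain ⟨ω₀, -⟩ := μ.support_nonempty
  let φ : A → B := fun a => if h : ∃ ω ∈ μ.support, f ω = a then g h.choose else g ω₀
  have : ent μ g = ent μ (φ ∘ f) := by
    unfold ent prob
    rw [map_congr_of_support (μ := μ) (f := g) (g := φ ∘ f)]
    intro ω hω
    have hex : ∃ ω' ∈ μ.support, f ω' = f ω := ⟨ω, hω, rfl⟩
    simp only [Function.comp, φ, dif_pos hex]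
    exact h ω hω _ hex.choose_spec.1 hex.choose_spec.2.symm
  rw [this]; exact ent_comp_le f φ

/-- Nonnegativity of I(f; g | h): each slice h = c is a nonnegative matrix, to which
`negMulLog_sum_submodular` applies without normalization. -/
lemma ent_triple_submodular (f : Ω → A) (g : Ω → B) (h : Ω → C) :
    ent μ (fun ω => (f ω, g ω, h ω)) + ent μ h
      ≤ ent μ (fun ω => (f ω, h ω)) + ent μ (fun ω => (g ω, h ω)) := by
  classical
  set t : Ω → A × B × C := fun ω => (f ω, g ω, h ω)
  have e1 : ∀ c, prob μ h c = ∑ a, ∑ b, prob μ t (a, b, c) := fun c => by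
    have : prob μ h c = _ := prob_comp (μ := μ) t (fun x => x.2.2) c
    rw [this]
    simp [Fintype.sum_prod_type]
  have e2 : ∀ a c, prob μ (fun ω => (f ω, h ω)) (a, c) = ∑ b, prob μ t (a, b, c) := fun a c => by
    have : prob μ (fun ω => (f ω, h ω)) (a, c) = _ :=
      prob_comp (μ := μ) t (fun x => (x.1, x.2.2)) (a, c)
    rw [this]
    simp [Fintype.sum_prod_type, ite_and]
  have e3 : ∀ b c, prob μ (fun ω => (g ω, h ω)) (b, c) = ∑ a, prob μ t (a, b, c) := fun b c => by
    have : prob μ (fun ω => (g ω, h ω)) (b, c) = _ :=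
      prob_comp (μ := μ) t (fun x => (x.2.1, x.2.2)) (b, c)
    rw [this]
    simp [Fintype.sum_prod_type]
  have key : ∀ c, _ := fun c => negMulLog_sum_submodular (q := fun a b => prob μ t (a, b, c))
    fun a b => prob_nonneg _ _
  have hsum := Finset.sum_le_sum fun c (_ : c ∈ Finset.univ) => key c
  simp only [Finset.sum_add_distrib] at hsum
  have s1 : ent μ t = ∑ c, ∑ a, ∑ b, Real.negMulLog (prob μ t (a, b, c)) := by
    unfold ent
    simp only [Fintype.sum_prod_type]
    rw [Finset.sum_comm (s := (Finset.univ : Finset C))]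
    exact Finset.sum_congr rfl fun a _ => Finset.sum_comm
  have s2 : ent μ (fun ω => (f ω, h ω)) = ∑ c, ∑ a, Real.negMulLog (∑ b, prob μ t (a, b, c)) := by
    unfold ent
    rw [Fintype.sum_prod_type, Finset.sum_comm]
    simp_rw [e2]
  have s3 : ent μ (fun ω => (g ω, h ω)) = ∑ c, ∑ b, Real.negMulLog (∑ a, prob μ t (a, b, c)) := by
    unfold ent
    rw [Fintype.sum_prod_type, Finset.sum_comm]
    simp_rw [e3]
  have s4 : ent μ h = ∑ c, Real.negMulLog (∑ a, ∑ b, prob μ t (a, b, c)) := by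
    unfold ent
    simp_rw [e1]
  rw [s1, s2, s3, s4]
  exact hsum

/-- Submodularity: if `f` and `g` each determine `h`, and jointly determine `u`, then
`H(u) + H(h) ≤ H(f) + H(g)`. -/
lemma ent_add_le {f : Ω → A} {g : Ω → B} {h : Ω → C} {u : Ω → D} (hf : Det μ f h)
    (hg : Det μ g h) (hu : Det μ (fun ω => (f ω, g ω)) u) :
    ent μ u + ent μ h ≤ ent μ f + ent μ g := by
  have h1 := ent_triple_submodular (μ := μ) f g h
  have h2 : ent μ (fun ω => (f ω, h ω)) ≤ ent μ f := ent_le_of_det fun ω hω ω' hω' e =>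
    Prod.ext e (hf ω hω ω' hω' e)
  have h3 : ent μ (fun ω => (g ω, h ω)) ≤ ent μ g := ent_le_of_det fun ω hω ω' hω' e =>
    Prod.ext e (hg ω hω ω' hω' e)
  have h4 : ent μ u ≤ ent μ (fun ω => (f ω, g ω, h ω)) := ent_le_of_det fun ω hω ω' hω' e =>
    hu ω hω ω' hω' (by simp only [Prod.mk.injEq] at e ⊢; exact ⟨e.1, e.2.1⟩)
  linarith

lemma prob_le_one (f : Ω → A) (a : A) : prob μ f a ≤ 1 := by
  rw [← sum_prob (μ := μ) f]
  exact Finset.single_le_sum (fun a _ => prob_nonneg f a) (Finset.mem_univ a)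

lemma ent_nonneg (f : Ω → A) : 0 ≤ ent μ f :=
  Finset.sum_nonneg fun a _ => Real.negMulLog_nonneg (prob_nonneg f a) (prob_le_one f a)

/-- Subadditivity: if `f` and `g` jointly determine `u`, then `H(u) ≤ H(f) + H(g)`. -/
lemma ent_le_add {f : Ω → A} {g : Ω → B} {u : Ω → D}
    (hu : Det μ (fun ω => (f ω, g ω)) u) : ent μ u ≤ ent μ f + ent μ g := by
  have := ent_add_le (h := fun _ => ()) (fun _ _ _ _ _ => rfl) (fun _ _ _ _ _ => rfl) hu
  linarith [ent_nonneg (μ := μ) (fun _ => ())]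

lemma ent_le_log_card (f : Ω → A) : ent μ f ≤ Real.log (Fintype.card A) := by
  obtain ⟨ω₀, -⟩ := μ.support_nonempty
  have hn : 0 < (Fintype.card A : ℝ) := by
    exact_mod_cast Fintype.card_pos_iff.2 ⟨f ω₀⟩
  have key : ∀ a, Real.negMulLog (prob μ f a)
      ≤ prob μ f a * Real.log (Fintype.card A) + (1 / Fintype.card A - prob μ f a) := by
    intro a
    rcases (prob_nonneg (μ := μ) f a).eq_or_lt with h | h
    · rw [← h]; simp
    · have := Real.log_le_sub_one_of_pos (x := 1 / (Fintype.card A * prob μ f a)) (by positivity)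
      rw [Real.log_div one_ne_zero (by positivity), Real.log_mul hn.ne' h.ne', Real.log_one] at this
      have h4 := mul_le_mul_of_nonneg_left this h.le
      have h5 : prob μ f a * (1 / (Fintype.card A * prob μ f a) - 1)
        = 1 / Fintype.card A - prob μ f a := by field_simp
      rw [Real.negMulLog]
      nlinarith
  have := Finset.sum_le_sum fun a (_ : a ∈ Finset.univ) => key a
  rw [Finset.sum_add_distrib, ← Finset.sum_mul, Finset.sum_sub_distrib, sum_prob] at this
  simp only [Finset.sum_const, Finset.card_univ, nsmul_eq_mul] at this
  rw [mul_one_div_cancel hn.ne'] at this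
  unfold ent; linarith

lemma ent_of_map_eq_uniform [Nonempty A] {f : Ω → A} (h : μ.map f = PMF.uniformOfFintype A) :
    ent μ f = Real.log (Fintype.card A) := by
  have hn : (Fintype.card A : ℝ) ≠ 0 := by
    exact_mod_cast Fintype.card_ne_zero
  simp [ent, prob, h, Real.negMulLog, hn]

end Entropy

/-! ### Mutual information and independence -/

section MutualInfo

variable {A B : Type} [Fintype A] [Fintype B] (p : PMF (A × B))

lemma toReal_map_fst (a : A) : ((p.map Prod.fst) a).toReal = ∑ b, (p (a, b)).toReal := by
  classical
  rw [toReal_map_apply, Fintype.sum_prod_type, Finset.sum_comm]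
  simp

lemma toReal_map_snd (b : B) : ((p.map Prod.snd) b).toReal = ∑ a, (p (a, b)).toReal := by
  classical
  rw [toReal_map_apply]
  simp [Fintype.sum_prod_type]

lemma mutualInfo_mul_log_two : mutualInfo p * Real.log 2
    = ∑ a, Real.negMulLog (∑ b, (p (a, b)).toReal) + ∑ b, Real.negMulLog (∑ a, (p (a, b)).toReal)
      - ∑ a, ∑ b, Real.negMulLog (p (a, b)).toReal := by
  have h : Real.log 2 ≠ 0 := (Real.log_pos (by norm_num)).ne'
  unfold mutualInfo entropy
  simp_rw [← Finset.sum_div]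
  simp_rw [toReal_map_fst, toReal_map_snd, Fintype.sum_prod_type]
  field_simp

lemma eq_mul_of_mutualInfo_eq_zero (h : mutualInfo p = 0) (a : A) (b : B) :
    (p (a, b)).toReal = (∑ b, (p (a, b)).toReal) * ∑ a, (p (a, b)).toReal := by
  refine eq_mul_of_negMulLog_sum_eq (q := fun a b => (p (a, b)).toReal)
    (fun _ _ => ENNReal.toReal_nonneg) ?_ ?_ a b
  · rw [← sum_toReal_eq_one p, Fintype.sum_prod_type]
  · have := mutualInfo_mul_log_two p
    rw [h, zero_mul] at this
    linarith

/-- The hypothesis makes the first variable uniform and independent of the second, so the joint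
entropy is log |A| plus that of the second. -/
lemma mutualInfo_eq_zero_of_forall_eq (h : ∀ a a' b, p (a, b) = p (a', b)) : mutualInfo p = 0 := by
  obtain ⟨⟨a₀, b₀⟩, -⟩ := p.support_nonempty
  have hl : Real.log 2 ≠ 0 := (Real.log_pos (by norm_num)).ne'
  refine (mul_eq_zero.1 ?_).resolve_right hl
  rw [mutualInfo_mul_log_two]
  have hn : (Fintype.card A : ℝ) ≠ 0 := by
    exact_mod_cast (Fintype.card_pos_iff.2 ⟨a₀⟩).ne'
  set f : B → ℝ := fun b => (p (a₀, b)).toReal with hf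
  have e : ∀ a b, (p (a, b)).toReal = f b := fun a b => by rw [h a a₀ b]
  have h1 : Fintype.card A * ∑ b, f b = 1 := by
    rw [← sum_toReal_eq_one p, Fintype.sum_prod_type]
    simp [e]
  have h2 : ∑ b, f b = (Fintype.card A : ℝ)⁻¹ := by
    field_simp; linarith
  simp_rw [e]
  simp only [Finset.sum_const, Finset.card_univ, nsmul_eq_mul, Real.negMulLog_mul]
  rw [Finset.sum_add_distrib, ← Finset.sum_mul, ← Finset.mul_sum, h2]
  simp only [Real.negMulLog, Real.log_inv]
  field_simp
  ring

end MutualInfo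

/-! ### Demand privacy as invariance of a user's view -/

namespace Scheme

variable {N K F : ℕ} (c : Scheme N K F)

/-- The joint law of the files and the randomness, without the demands. -/
def baseLaw : PMF (Files N F × c.P × (∀ k, c.S k)) :=
  (PMF.uniformOfFintype (Files N F)).bind fun w =>
    c.lawP.bind fun p => c.lawS.bind fun s => PMF.pure (w, p, s)

/-- The law of the view of user `k` when the demand vector is `d`. -/
def viewLaw (k : Fin K) (d : Demands N K) : PMF (c.View k) :=
  c.baseLaw.map fun ω => c.view k ω.1 d ω.2.1 ω.2.2

lemma mem_support_baseLaw {ω : Files N F × c.P × (∀ k, c.S k)} (h : ω ∈ c.baseLaw.support) :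
    ω.2.1 ∈ c.lawP.support ∧ ω.2.2 ∈ c.lawS.support := by
  simp only [baseLaw, PMF.mem_support_bind_iff, PMF.mem_support_pure_iff] at h
  obtain ⟨w, -, p, hp, s, hs, rfl⟩ := h
  exact ⟨hp, hs⟩

lemma baseLaw_map_fst : c.baseLaw.map Prod.fst = PMF.uniformOfFintype (Files N F) := by
  simp [baseLaw, PMF.map_bind, PMF.pure_map, PMF.bind_const, PMF.bind_pure]

variable [NeZero N]

lemma law_map {A : Type} (f : Files N F × Demands N K × c.P × (∀ k, c.S k) → A) :
    c.law.map f = (PMF.uniformOfFintype (Demands N K)).bind fun d =>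
      c.baseLaw.map fun ω => f (ω.1, d, ω.2.1, ω.2.2) := by
  simp only [law, baseLaw, PMF.map_bind, PMF.pure_map]
  rw [PMF.bind_comm]

/-- The demand vector in which user `k` demands `x` and the others demand `o`. -/
def glue (k : Fin K) (o : OtherDemands N K k) (x : Fin N) : Demands N K :=
  fun i => if h : i = k then x else o ⟨i, h⟩

lemma glue_self (k : Fin K) (o : OtherDemands N K k) (x : Fin N) : glue k o x k = x := by
  simp [glue]

lemma glue_restrict (k : Fin K) (d : Demands N K) : glue k (fun i => d i.1) (d k) = d := by
  ext i; by_cases h : i = k <;> simp [glue, h]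

lemma restrict_glue (k : Fin K) (o : OtherDemands N K k) (x : Fin N) :
    (fun i => glue k o x i.1 : OtherDemands N K k) = o := by
  ext i; simp [glue, i.2]

lemma viewLaw_apply_of_ne (k : Fin K) (d : Demands N K) (v : c.View k) (h : d k ≠ v.1) :
    c.viewLaw k d v = 0 := by
  rw [viewLaw, PMF.apply_eq_zero_iff, PMF.support_map]
  rintro ⟨ω, -, rfl⟩
  exact h rfl

/-- The joint law of the demands of the others and the view of user `k`. -/
lemma joint_apply (k : Fin K) (o : OtherDemands N K k) (v : c.View k) :
    (c.law.map fun ω =>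
      ((fun i => ω.2.1 i.1 : OtherDemands N K k), c.view k ω.1 ω.2.1 ω.2.2.1 ω.2.2.2)) (o, v)
      = (Fintype.card (Demands N K) : ENNReal)⁻¹ * c.viewLaw k (glue k o v.1) v := by
  classical
  rw [law_map, PMF.bind_apply, tsum_fintype]
  have key : ∀ d : Demands N K, (c.baseLaw.map fun ω =>
      ((fun i => d i.1 : OtherDemands N K k), c.view k ω.1 d ω.2.1 ω.2.2)) (o, v)
      = if d = glue k o v.1 then c.viewLaw k (glue k o v.1) v else 0 := by
    intro d
    split_ifs with hd
    · subst hd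
      rw [viewLaw, PMF.map_apply, PMF.map_apply]
      refine tsum_congr fun ω => ?_
      simp only [restrict_glue, Prod.mk.injEq, true_and]
      congr
    · rw [PMF.apply_eq_zero_iff, PMF.support_map]
      rintro ⟨ω, -, h⟩
      rw [Prod.mk.injEq] at h
      obtain ⟨rfl, rfl⟩ := h
      exact hd (glue_restrict k d).symm
  simp only [key, PMF.uniformOfFintype_apply]
  simp

/-- The joint mass at (o, v) is a constant times the view law at the glued demands, hence does not
depend on o. -/
lemma isDemandPrivate_of_viewLaw_eq
    (h : ∀ k (d d' : Demands N K), d k = d' k → c.viewLaw k d = c.viewLaw k d') :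
    c.IsDemandPrivate := by
  intro k
  refine mutualInfo_eq_zero_of_forall_eq _ fun o o' v => ?_
  rw [joint_apply, joint_apply, h k (glue k o v.1) (glue k o' v.1) (by simp [glue_self])]

/-- Independence gives p(o, v) = p(o) p(v), and p(o) is the same for all o because demands are
uniform. Thus p(o, v) does not depend on o, and neither does the view law, which is proportional to
it. -/
lemma IsDemandPrivate.viewLaw_eq {c : Scheme N K F} (hc : c.IsDemandPrivate) (k : Fin K)
    {d d' : Demands N K} (hd : d k = d' k) : c.viewLaw k d = c.viewLaw k d' := by
  classical
  set n : ℝ := ((Fintype.card (Demands N K) : ℕ) : ℝ) with hn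
  have hn0 : n ≠ 0 := by
    have : Nonempty (Demands N K) := ⟨d⟩
    rw [hn]; exact_mod_cast Fintype.card_ne_zero
  set p := c.law.map fun ω =>
      ((fun i => ω.2.1 i.1 : OtherDemands N K k), c.view k ω.1 ω.2.1 ω.2.2.1 ω.2.2.2) with hp
  have hj : ∀ o v, (p (o, v)).toReal = n⁻¹ * (c.viewLaw k (glue k o v.1) v).toReal := by
    intro o v
    rw [hp, joint_apply]; simp [hn]
  -- The views split according to the user's own demand; each of its N values contributes the full
  -- mass of one view law.
  have hrow : ∀ o, ∑ v, (p (o, v)).toReal = n⁻¹ * N := by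
    intro o
    simp_rw [hj]
    rw [← Finset.mul_sum]
    congr 1
    have e : ∀ v : c.View k, (c.viewLaw k (glue k o v.1) v).toReal
        = ∑ x : Fin N, (c.viewLaw k (glue k o x) v).toReal := by
      intro v
      rw [Finset.sum_eq_single v.1]
      · intro x _ hx
        rw [viewLaw_apply_of_ne _ _ _ _ (by rwa [glue_self])]; rfl
      · simp
    simp_rw [e]
    rw [Finset.sum_comm]
    simp_rw [sum_toReal_eq_one]
    simp
  ext v
  by_cases hv : d k = v.1
  swap
  · rw [viewLaw_apply_of_ne _ _ _ _ hv, viewLaw_apply_of_ne _ _ _ _ (hd ▸ hv)]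
  have h1 : glue k (fun i => d i.1) v.1 = d := by rw [← hv, glue_restrict]
  have h2 : glue k (fun i => d' i.1) v.1 = d' := by rw [← hv, hd, glue_restrict]
  have e1 := eq_mul_of_mutualInfo_eq_zero p (hc k) (fun i => d i.1) v
  have e2 := eq_mul_of_mutualInfo_eq_zero p (hc k) (fun i => d' i.1) v
  rw [hrow, hj, h1] at e1
  rw [hrow, hj, h2] at e2
  have e3 := mul_left_cancel₀ (inv_ne_zero hn0) (e1.trans e2.symm)
  exact (ENNReal.toReal_eq_toReal_iff' (PMF.apply_ne_top _ _) (PMF.apply_ne_top _ _)).1 e3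

end Scheme

/-! ### Converse: entropy bounds for two users -/

namespace Scheme

variable {N F : ℕ} (c : Scheme N 2 F)

/-- What user `k` holds before the broadcast. -/
def held (k : Fin 2) (ω : Files N F × c.P × (∀ k, c.S k)) : c.S k × Fin c.cacheSize :=
  (ω.2.2 k, c.cache k (ω.2.2 k) ω.2.1 ω.1)

/-- The broadcast for the demand vector `d`. -/
def sent (d : Demands N 2) (ω : Files N F × c.P × (∀ k, c.S k)) : c.J × Fin c.payloadSize :=
  (c.aux d ω.2.1 ω.2.2, c.payload ω.1 d ω.2.1 ω.2.2)

/-- The first `i` files, the others being masked. -/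
def firstFiles (i : ℕ) (ω : Files N F × c.P × (∀ k, c.S k)) : Files N F :=
  fun n => if n.1 < i then ω.1 n else fun _ => false

lemma firstFiles_eq_iff {i : ℕ} {ω ω' : Files N F × c.P × (∀ k, c.S k)} :
    c.firstFiles i ω = c.firstFiles i ω' ↔ ∀ n : Fin N, n.1 < i → ω.1 n = ω'.1 n := by
  simp only [firstFiles, funext_iff (f := fun n : Fin N => _)]
  refine forall_congr' fun n => ?_
  split_ifs with h <;> simp [h]

variable {c}

lemma IsDecodable.file_eq (hc : c.IsDecodable) {ω ω' : Files N F × c.P × (∀ k, c.S k)}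
    (hω : ω ∈ c.baseLaw.support) (hω' : ω' ∈ c.baseLaw.support) {k : Fin 2} {d : Demands N 2}
    (h1 : c.held k ω = c.held k ω') (h2 : c.sent d ω = c.sent d ω') :
    ω.1 (d k) = ω'.1 (d k) := by
  simp only [held, sent, Prod.mk.injEq] at h1 h2
  have e := hc k ω.1 d _ (c.mem_support_baseLaw hω).1 _ (c.mem_support_baseLaw hω).2
  have e' := hc k ω'.1 d _ (c.mem_support_baseLaw hω').1 _ (c.mem_support_baseLaw hω').2
  rw [← e, ← e', h1.2, h1.1, h2.1, h2.2]

lemma ent_files : ent c.baseLaw Prod.fst = N * (F * Real.log 2) := by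
  rw [ent_of_map_eq_uniform c.baseLaw_map_fst]
  simp

/-- All N files carry exactly NF bits, and the files beyond the first i carry at most (N - i)F of
them. -/
lemma le_ent_firstFiles {i : ℕ} (hi : i ≤ N) :
    i * (F * Real.log 2) ≤ ent c.baseLaw (c.firstFiles i) := by
  have h1 : ent c.baseLaw Prod.fst ≤ ent c.baseLaw (c.firstFiles i)
      + ent c.baseLaw (fun ω => fun n : {n : Fin N // ¬ n.1 < i} => ω.1 n.1) := by
    refine ent_le_add fun ω _ ω' _ e => ?_
    simp only [Prod.mk.injEq, firstFiles_eq_iff] at e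
    ext1 n
    by_cases h : n.1 < i
    · exact e.1 n h
    · exact congrFun e.2 ⟨n, h⟩
  have h2 := ent_le_log_card (μ := c.baseLaw)
    (fun ω => fun n : {n : Fin N // ¬ n.1 < i} => ω.1 n.1)
  have h3 : Fintype.card {n : Fin N // ¬ n.1 < i} = N - i := by
    rw [Fintype.card_subtype_compl]
    simp only [Fintype.card_fin]
    congr 1
    rw [Fintype.card_subtype]
    rw [Fin.card_filter_val_lt]
    exact min_eq_right hi
  rw [Fintype.card_fun, h3] at h2
  simp only [Fintype.card_pi, Fintype.card_bool, Finset.prod_const, Finset.card_univ,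
    Fintype.card_fin, Nat.cast_pow, Nat.cast_ofNat, Real.log_pow, Nat.cast_sub hi] at h2
  rw [ent_files] at h1
  nlinarith

/-- The entropy of what user `k` holds together with the first `j` files. -/
def entOne (c : Scheme N 2 F) (k : Fin 2) (j : ℕ) : ℝ :=
  ent c.baseLaw fun ω => (c.held k ω, c.firstFiles j ω)

/-- The entropy of what both users hold together with the first `j` files. -/
def entBoth (c : Scheme N 2 F) (j : ℕ) : ℝ :=
  ent c.baseLaw fun ω => (c.held 0 ω, c.held 1 ω, c.firstFiles j ω)

lemma le_entBoth {j : ℕ} (hj : j ≤ N) : j * (F * Real.log 2) ≤ entBoth c j :=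
  (le_ent_firstFiles hj).trans <| ent_le_of_det fun ω _ ω' _ e => by
    simp only [Prod.mk.injEq] at e; exact e.2.2

lemma le_entOne (k : Fin 2) {j : ℕ} (hj : j ≤ N) : j * (F * Real.log 2) ≤ entOne c k j :=
  (le_ent_firstFiles hj).trans <| ent_le_of_det fun ω _ ω' _ e => by
    simp only [Prod.mk.injEq] at e; exact e.2

lemma entOne_zero_le (k : Fin 2) : entOne c k 0 ≤ ent c.baseLaw (c.held k) :=
  ent_le_of_det fun ω _ ω' _ e => by
    simp only [Prod.mk.injEq, firstFiles_eq_iff]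
    exact ⟨e, fun n hn => absurd hn (Nat.not_lt_zero _)⟩

/-- Adjoining the broadcast to (Z_k, W_{<j}) reveals file j for free. -/
lemma IsDecodable.ent_held_sent_le (hc : c.IsDecodable) {k : Fin 2} {d : Demands N 2} {j : ℕ}
    (hd : (d k).1 = j) :
    ent c.baseLaw (fun ω => (c.held k ω, c.sent d ω, c.firstFiles (j + 1) ω))
      ≤ entOne c k j + ent c.baseLaw (c.sent d) := by
  refine ent_le_add fun ω hω ω' hω' e => ?_
  simp only [Prod.mk.injEq, firstFiles_eq_iff] at e ⊢
  refine ⟨e.1.1, e.2, fun n hn => ?_⟩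
  rcases Nat.lt_succ_iff_lt_or_eq.1 hn with h | h
  · exact e.1.2 n h
  · obtain rfl : d k = n := Fin.ext (hd.trans h.symm)
    exact hc.file_eq hω hω' e.1.1 e.2

lemma IsDecodable.entOne_succ_le (hc : c.IsDecodable) {k : Fin 2} {d : Demands N 2} {j : ℕ}
    (hd : (d k).1 = j) :
    entOne c k (j + 1) ≤ entOne c k j + ent c.baseLaw (c.sent d) :=
  le_trans (ent_le_of_det fun ω _ ω' _ e => by
    simp only [Prod.mk.injEq] at e ⊢; exact ⟨e.1, e.2.2⟩) (hc.ent_held_sent_le hd)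

lemma held_eq_of_both {k : Fin 2} {ω ω' : Files N F × c.P × (∀ k, c.S k)}
    (h0 : c.held 0 ω = c.held 0 ω') (h1 : c.held 1 ω = c.held 1 ω') :
    c.held k ω = c.held k ω' := by
  fin_cases k
  · exact h0
  · exact h1

/-- A broadcast delivering file `j` to user `k` and file `i > j` to the other user extends both
`entOne` and `entBoth` by one file. -/
lemma IsDecodable.entBoth_succ_add_le (hc : c.IsDecodable) {k k' : Fin 2} {d : Demands N 2}
    {i j : ℕ} (hj : (d k).1 = j) (hi : (d k').1 = i) (hij : j < i) :
    entBoth c (i + 1) + entOne c k (j + 1)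
      ≤ entBoth c i + (entOne c k j + ent c.baseLaw (c.sent d)) := by
  refine le_trans ?_ (add_le_add le_rfl (hc.ent_held_sent_le hj))
  -- Submodularity for (Z_0, Z_1, W_{<i}) and (Z_k, X_d, W_{≤j}): since j < i both contain (Z_k,
  -- W_{≤j}), and together they decode file i for user k'.
  refine ent_add_le (fun ω _ ω' _ e => ?_) (fun ω _ ω' _ e => ?_) (fun ω hω ω' hω' e => ?_)
  · simp only [Prod.mk.injEq, firstFiles_eq_iff] at e ⊢
    exact ⟨held_eq_of_both e.1 e.2.1, fun n hn => e.2.2 n (by omega)⟩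
  · simp only [Prod.mk.injEq] at e ⊢
    exact ⟨e.1, e.2.2⟩
  · simp only [Prod.mk.injEq, firstFiles_eq_iff] at e ⊢
    refine ⟨e.1.1, e.1.2.1, fun n hn => ?_⟩
    rcases Nat.lt_succ_iff_lt_or_eq.1 hn with h | h
    · exact e.1.2.2 n h
    · obtain rfl : d k' = n := Fin.ext (hi.trans h.symm)
      exact hc.file_eq hω hω' (held_eq_of_both e.1.1 e.1.2.1) e.2.2.1

/-- Broadcasts delivering file `j` to one user and one of the files `j + 1`, `j + 2` to the
other. -/
lemma IsDecodable.entBoth_add_three_le (hc : c.IsDecodable) {d d' : Demands N 2} {j : ℕ}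
    (h0 : (d 0).1 = j) (h1 : (d 1).1 = j + 1) (h0' : (d' 0).1 = j + 2) (h1' : (d' 1).1 = j) :
    entBoth c (j + 3) + ent c.baseLaw (c.firstFiles (j + 1))
      ≤ (entOne c 0 j + ent c.baseLaw (c.sent d))
        + (entOne c 1 j + ent c.baseLaw (c.sent d')) := by
  refine le_trans ?_ (add_le_add (hc.ent_held_sent_le h0) (hc.ent_held_sent_le h1'))
  -- The common part is W_{≤j}. In the union each cache meets the other broadcast: user 1 decodes
  -- file j + 1 from X_d and user 0 decodes file j + 2 from X_{d'}.
  refine ent_add_le (fun ω _ ω' _ e => ?_) (fun ω _ ω' _ e => ?_) (fun ω hω ω' hω' e => ?_)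
  · simp only [Prod.mk.injEq] at e
    exact e.2.2
  · simp only [Prod.mk.injEq] at e
    exact e.2.2
  · simp only [Prod.mk.injEq, firstFiles_eq_iff] at e ⊢
    refine ⟨e.1.1, e.2.1, fun n hn => ?_⟩
    have : n.1 < j + 1 ∨ n.1 = j + 1 ∨ n.1 = j + 2 := by omega
    rcases this with h | h | h
    · exact e.1.2.2 n h
    · obtain rfl : d 1 = n := Fin.ext (h1.trans h.symm)
      exact hc.file_eq hω hω' e.2.1 e.1.2.1
    · obtain rfl : d' 0 = n := Fin.ext (h0'.trans h.symm)
      exact hc.file_eq hω hω' e.1.1 e.2.2.1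

variable {m r : ℝ}

/-- Demands in which user `k` wants file `a` and the other user wants file `b`. -/
def demand (k : Fin 2) (a b : Fin N) : Demands N 2 := fun i => if i = k then a else b

lemma IsDecodable.chain (hc : c.IsDecodable) (hr : ∀ d, ent c.baseLaw (c.sent d) ≤ r)
    (k : Fin 2) {i j : ℕ} (hij : j < i) (t : ℕ) (ht : i + t ≤ N) :
    entBoth c (i + t) + entOne c k (j + t) ≤ entBoth c i + entOne c k j + t * r := by
  induction t with
  | zero => simp
  | succ t ih =>
    -- In `Fin 2`, k + 1 is the other user.
    have hk : k + 1 ≠ k := by fin_cases k <;> decide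
    have := hc.entBoth_succ_add_le (k := k) (k' := k + 1)
      (d := demand k ⟨j + t, by omega⟩ ⟨i + t, by omega⟩) (i := i + t) (j := j + t)
      (by simp [demand]) (by simp [demand, hk]) (by omega)
    have h2 := ih (by omega)
    have h3 := hr (demand k ⟨j + t, by omega⟩ ⟨i + t, by omega⟩)
    push_cast
    simp only [← add_assoc]
    linarith

/-- One cache and N broadcasts recover the whole library. -/
lemma IsDecodable.single_user_bound (hc : c.IsDecodable)
    (hm : ∀ k, ent c.baseLaw (c.held k) ≤ m) (hr : ∀ d, ent c.baseLaw (c.sent d) ≤ r) :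
    N * (F * Real.log 2) ≤ m + N * r := by
  have key : ∀ t ≤ N, entOne c 0 t ≤ m + t * r := by
    intro t
    induction t with
    | zero => intro _; simpa using (entOne_zero_le 0).trans (hm 0)
    | succ t ih =>
      intro ht
      have := hc.entOne_succ_le (k := 0) (d := fun _ => ⟨t, ht⟩) (j := t) rfl
      have h2 := hr (fun _ => ⟨t, ht⟩)
      have h3 := ih (by omega)
      push_cast; linarith
  exact (le_entOne 0 le_rfl).trans (key N le_rfl)

/-- Two caches and the single broadcast for the demands (0, 1) recover both files. -/
lemma IsDecodable.two_file_bound {c : Scheme 2 2 F} (hc : c.IsDecodable)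
    (hm : ∀ k, ent c.baseLaw (c.held k) ≤ m) (hr : ∀ d, ent c.baseLaw (c.sent d) ≤ r) :
    2 * (F * Real.log 2) ≤ 2 * m + r := by
  have h1 : ent c.baseLaw (fun ω => (c.held 0 ω, c.held 1 ω))
      ≤ ent c.baseLaw (c.held 0) + ent c.baseLaw (c.held 1) :=
    ent_le_add fun _ _ _ _ e => e
  have h2 : ent c.baseLaw Prod.fst ≤ ent c.baseLaw (fun ω => (c.held 0 ω, c.held 1 ω))
      + ent c.baseLaw (c.sent id) := by
    refine ent_le_add fun ω hω ω' hω' e => ?_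
    simp only [Prod.mk.injEq] at e
    ext1 n
    exact hc.file_eq hω hω' (d := id) (held_eq_of_both e.1.1 e.1.2) e.2
  rw [ent_files] at h2
  have := hm 0
  have := hm 1
  have := hr id
  push_cast at h2
  linarith

lemma IsDecodable.two_user_bound (hc : c.IsDecodable) (hN : 3 ≤ N)
    (hm : ∀ k, ent c.baseLaw (c.held k) ≤ m) (hr : ∀ d, ent c.baseLaw (c.sent d) ≤ r) :
    2 * N * (F * Real.log 2) ≤ 3 * m + N * r := by
  obtain ⟨t, rfl⟩ := Nat.exists_eq_add_of_le hN
  have start : ∀ j, (hj : j + 3 ≤ 3 + t) → entBoth c (j + 3) + (j + 1 : ℕ) * (F * Real.log 2)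
      ≤ entOne c 0 j + entOne c 1 j + 2 * r := by
    intro j hj
    have := hc.entBoth_add_three_le (j := j)
      (d := demand 0 ⟨j, by omega⟩ ⟨j + 1, by omega⟩) (d' := demand 0 ⟨j + 2, by omega⟩ ⟨j, by omega⟩)
      (by simp [demand]) (by simp [demand]) (by simp [demand]) (by simp [demand])
    have h1 := hr (demand 0 ⟨j, by omega⟩ ⟨j + 1, by omega⟩)
    have h2 := hr (demand 0 ⟨j + 2, by omega⟩ ⟨j, by omega⟩)
    have h3 := le_ent_firstFiles (c := c) (i := j + 1) (by omega)
    linarith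
  have s0 := start 0 (by omega)
  have s1 := start t (by omega)
  have c0 := hc.chain hr 0 (i := 3) (j := 0) (by omega) t le_rfl
  have c1 := hc.chain hr 1 (i := 3) (j := 0) (by omega) t le_rfl
  have z0 := (entOne_zero_le (c := c) 0).trans (hm 0)
  have z1 := (entOne_zero_le (c := c) 1).trans (hm 1)
  have b := le_entBoth (c := c) (j := 3 + t) le_rfl
  rw [zero_add] at c0 c1 s0
  rw [add_comm t 3] at s1
  push_cast at *
  -- The combination is 2·s0 + s1 + c0 + c1 with 3·b, 3·z0 and 3·z1: all intermediate entropies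
  -- cancel, leaving twice the claim.
  linarith

/-- W_0 is decoded from the view of user k, so (X_d, W_0) is a function of that view, whose law
depends on d only through d k. -/
lemma IsDecodable.ent_sent_eq [NeZero N] (hc : c.IsDecodable) (hp : c.IsDemandPrivate) (k : Fin 2)
    {d d' : Demands N 2} (hd : (d k).1 = 0) (hd' : (d' k).1 = 0) :
    ent c.baseLaw (fun ω => (c.sent d ω, c.firstFiles 1 ω))
      = ent c.baseLaw (fun ω => (c.sent d' ω, c.firstFiles 1 ω)) := by
  let φ : c.View k → (c.J × Fin c.payloadSize) × Files N F := fun v =>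
    ((v.2.2.1, v.2.2.2.1), fun n => if n.1 < 1 then
      c.decode k v.1 v.2.1 v.2.2.1 v.2.2.2.1 v.2.2.2.2 else fun _ => false)
  have key : ∀ d : Demands N 2, (d k).1 = 0 →
      c.baseLaw.map (fun ω => (c.sent d ω, c.firstFiles 1 ω)) = (c.viewLaw k d).map φ := by
    intro d hd
    rw [viewLaw, PMF.map_comp]
    refine map_congr_of_support fun ω hω => ?_
    simp only [Function.comp, φ, view, sent, Prod.mk.injEq, true_and]
    ext1 n
    change (if n.1 < 1 then ω.1 n else fun _ => false) = _
    split_ifs with h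
    · obtain rfl : d k = n := Fin.ext (by omega)
      rw [hc k ω.1 d _ (c.mem_support_baseLaw hω).1 _ (c.mem_support_baseLaw hω).2]
    · rfl
  unfold ent prob
  rw [key d hd, key d' hd', hp.viewLaw_eq k (Fin.ext (hd.trans hd'.symm))]

lemma IsDecodable.private_bound [NeZero N] (hc : c.IsDecodable) (hp : c.IsDemandPrivate)
    (hN : 2 ≤ N) (hm : ∀ k, ent c.baseLaw (c.held k) ≤ m)
    (hr : ∀ d, ent c.baseLaw (c.sent d) ≤ r) :
    (2 * N + 1) * (F * Real.log 2) ≤ 3 * m + (N + 1) * r := by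
  obtain ⟨t, rfl⟩ := Nat.exists_eq_add_of_le (show 1 ≤ N by omega)
  -- Under d both users want file 0; under d' user 0 wants the last file instead, while user 1 still
  -- wants file 0.
  let d : Demands (1 + t) 2 := fun _ => ⟨0, by omega⟩
  let d' : Demands (1 + t) 2 := demand 0 ⟨t, by omega⟩ ⟨0, by omega⟩
  have h1 : entBoth c 1 + ent c.baseLaw (fun ω => (c.sent d ω, c.firstFiles 1 ω))
      ≤ (entOne c 0 0 + ent c.baseLaw (c.sent d)) + (entOne c 1 0 + ent c.baseLaw (c.sent d)) := by
    refine le_trans ?_ (add_le_add (hc.ent_held_sent_le (d := d) rfl)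
      (hc.ent_held_sent_le (d := d) rfl))
    refine ent_add_le (fun ω _ ω' _ e => ?_) (fun ω _ ω' _ e => ?_) (fun ω hω ω' hω' e => ?_)
    · simp only [Prod.mk.injEq] at e ⊢
      exact e.2
    · simp only [Prod.mk.injEq] at e ⊢
      exact e.2
    · simp only [Prod.mk.injEq] at e ⊢
      exact ⟨e.1.1, e.2.1, e.1.2.2⟩
  -- Privacy against user 1 exchanges the two broadcasts, so that the term H(X_{d'}, W_0) cancels
  -- against the next inequality.
  rw [hc.ent_sent_eq hp 1 (d := d) (d' := d') rfl (by simp [d', demand])] at h1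
  -- From (Z_0, W_{<N-1}) and X_{d'} user 0 obtains the last file; both sides of the submodularity
  -- contain W_0 because N ≥ 2.
  have h2 : ent c.baseLaw Prod.fst + ent c.baseLaw (c.firstFiles 1)
      ≤ entOne c 0 t + ent c.baseLaw (fun ω => (c.sent d' ω, c.firstFiles 1 ω)) := by
    refine ent_add_le (fun ω _ ω' _ e => ?_) (fun ω _ ω' _ e => ?_) (fun ω hω ω' hω' e => ?_)
    · simp only [Prod.mk.injEq, firstFiles_eq_iff] at e ⊢
      exact fun n hn => e.2 n (by omega)
    · simp only [Prod.mk.injEq] at e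
      exact e.2
    · simp only [Prod.mk.injEq, firstFiles_eq_iff] at e
      ext1 n
      by_cases h : n.1 < t
      · exact e.1.2 n h
      · obtain rfl : d' 0 = n := Fin.ext (by simp [d', demand]; omega)
        exact hc.file_eq hω hω' e.1.1 e.2.1
  rw [ent_files] at h2
  have h3 := le_ent_firstFiles (c := c) (i := 1) (by omega)
  have c0 := hc.chain hr 0 (i := 1) (j := 0) (by omega) t le_rfl
  have z0 := (entOne_zero_le (c := c) 0).trans (hm 0)
  have z1 := (entOne_zero_le (c := c) 1).trans (hm 1)
  have b := le_entBoth (c := c) (j := 1 + t) le_rfl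
  have := hr d
  rw [zero_add] at c0
  push_cast at *
  linarith

end Scheme

/-! ### From entropy bounds to memory-rate bounds -/

lemma log_card_eq_len (A : Type) [Fintype A] : Real.log (Fintype.card A) = len A * Real.log 2 := by
  rw [len, Real.logb, div_mul_cancel₀ _ (Real.log_pos (by norm_num)).ne']

/-- A linear inequality satisfied by the entropies of all schemes holds for all achievable
memory-rate pairs. -/
lemma Achievable.bound {N : ℕ} [NeZero N] {M R : ℝ} (h : Achievable N 2 M R) {a b e : ℝ}
    (ha : 0 ≤ a) (hb : 0 ≤ b)
    (key : ∀ F (c : Scheme N 2 F) (m r : ℝ), c.IsDecodable → c.IsDemandPrivate →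
      (∀ k, ent c.baseLaw (c.held k) ≤ m) → (∀ d, ent c.baseLaw (c.sent d) ≤ r) →
      e * (F * Real.log 2) ≤ a * m + b * r) :
    e ≤ a * M + b * R := by
  have hl : 0 < Real.log 2 := Real.log_pos (by norm_num)
  have hε : ∀ ε : ℝ, 0 < ε → e ≤ a * M + b * R + ε * (2 * (a + b)) := by
    intro ε hε
    obtain ⟨F, hF, c, hc, hp, h1, h2, h3, h4⟩ := h ε hε 1
    have hF0 : 0 < (F : ℝ) := by exact_mod_cast hF
    -- One ε is the slack of the cache, the other pays for the shared randomness; below, likewise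
    -- for payload and auxiliary transmission.
    have hcache : ∀ k, ent c.baseLaw (c.held k) ≤ (M + 2 * ε) * F * Real.log 2 := by
      intro k
      have e1 : ent c.baseLaw (c.held k) ≤ _ := (ent_le_add (f := fun ω => (c.held k ω).1)
        (g := fun ω => (c.held k ω).2) fun _ _ _ _ e => e).trans
        (add_le_add (ent_le_log_card _) (ent_le_log_card _))
      rw [log_card_eq_len, log_card_eq_len] at e1
      nlinarith [h3 k]
    have hsent : ∀ d, ent c.baseLaw (c.sent d) ≤ (R + 2 * ε) * F * Real.log 2 := by
      intro d
      have e1 : ent c.baseLaw (c.sent d) ≤ _ := (ent_le_add (f := fun ω => (c.sent d ω).1)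
        (g := fun ω => (c.sent d ω).2) fun _ _ _ _ e => e).trans
        (add_le_add (ent_le_log_card _) (ent_le_log_card _))
      rw [log_card_eq_len, log_card_eq_len] at e1
      nlinarith
    have := key F c _ _ hc hp hcache hsent
    have h5 : e * (F * Real.log 2)
        ≤ (a * M + b * R + ε * (2 * (a + b))) * (F * Real.log 2) := by linarith
    exact le_of_mul_le_mul_right h5 (by positivity)
  refine le_of_forall_pos_le_add fun δ hδ => ?_
  have hs : 0 < 2 * (a + b) + 1 := by positivity
  refine (hε (δ / (2 * (a + b) + 1)) (by positivity)).trans ?_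
  have : δ / (2 * (a + b) + 1) * (2 * (a + b)) ≤ δ := by
    rw [div_mul_eq_mul_div, div_le_iff₀ hs]
    nlinarith
  linarith

/-! ### Private schemes from re-randomization -/

/-- A coded caching scheme for two users with arbitrary alphabets `A` (one file), `C` (cache),
`E` (payload), `S` (shared randomness of one user), `P` (private randomness) and `J` (auxiliary
transmission), in which all randomness is uniform. Privacy is witnessed by re-randomizations. -/
structure UniformScheme (N : ℕ) (A C E S P J : Type) where
  /-- cache encoding functions -/
  cache : Fin 2 → S → P → (Fin N → A) → C
  /-- encoding function of the payload -/
  payload : (Fin N → A) → Demands N 2 → P → (Fin 2 → S) → E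
  /-- encoding function of the auxiliary transmission -/
  aux : Demands N 2 → P → (Fin 2 → S) → J
  /-- decoding functions -/
  decode : Fin 2 → Fin N → S → J → E → C → A
  decode_eq : ∀ k w d p s,
    decode k (d k) (s k) (aux d p s) (payload w d p s) (cache k (s k) p w) = w (d k)
  exists_rerandomize : ∀ k (d d' : Demands N 2), d k = d' k →
    ∃ f : (Fin N → A) × P × (Fin 2 → S) → (Fin N → A) × P × (Fin 2 → S), Function.Injective f ∧
      ∀ ω, (f ω).2.2 k = ω.2.2 k ∧ aux d' (f ω).2.1 (f ω).2.2 = aux d ω.2.1 ω.2.2 ∧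
        payload (f ω).1 d' (f ω).2.1 (f ω).2.2 = payload ω.1 d ω.2.1 ω.2.2 ∧
        cache k ((f ω).2.2 k) (f ω).2.1 (f ω).1 = cache k (ω.2.2 k) ω.2.1 ω.1

lemma bind_uniformOfFintype_triple (W P S : Type) [Fintype W] [Nonempty W] [Fintype P] [Nonempty P]
    [Fintype S] [Nonempty S] :
    ((PMF.uniformOfFintype W).bind fun w => (PMF.uniformOfFintype P).bind fun p =>
      (PMF.uniformOfFintype S).bind fun s => PMF.pure (w, p, s))
      = PMF.uniformOfFintype (W × P × S) := by
  classical
  ext ⟨w, p, s⟩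
  rw [PMF.bind_apply, tsum_eq_single w, PMF.bind_apply, tsum_eq_single p, PMF.bind_apply,
    tsum_eq_single s]
  · simp only [PMF.uniformOfFintype_apply, PMF.pure_apply, if_true, mul_one]
    rw [← ENNReal.mul_inv (by simp) (by simp), ← ENNReal.mul_inv (by simp) (by simp)]
    rw [Fintype.card_prod, Fintype.card_prod]
    push_cast
    rfl
  · intro s' hs
    simp [hs.symm]
  · intro p' hp
    simp [PMF.bind_apply, hp.symm]
  · intro w' hw
    simp [PMF.bind_apply, hw.symm]

lemma map_uniformOfFintype_perm {α : Type} [Fintype α] [Nonempty α] (e : Equiv.Perm α) :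
    (PMF.uniformOfFintype α).map e = PMF.uniformOfFintype α := by
  classical
  ext x
  rw [PMF.map_apply, tsum_eq_single (e.symm x)]
  · simp
  · intro y hy
    rw [if_neg]
    rintro rfl
    simp at hy

namespace UniformScheme

variable {N : ℕ} {A C E S P J A' C' E' S' P' J' : Type}

/-- Memory sharing: each file is split into two parts, treated independently. -/
def prod (c : UniformScheme N A C E S P J) (c' : UniformScheme N A' C' E' S' P' J') :
    UniformScheme N (A × A') (C × C') (E × E') (S × S') (P × P') (J × J') where
  cache k s p w := (c.cache k s.1 p.1 fun n => (w n).1, c'.cache k s.2 p.2 fun n => (w n).2)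
  payload w d p s := (c.payload (fun n => (w n).1) d p.1 fun k => (s k).1,
    c'.payload (fun n => (w n).2) d p.2 fun k => (s k).2)
  aux d p s := (c.aux d p.1 fun k => (s k).1, c'.aux d p.2 fun k => (s k).2)
  decode k x s j e z := (c.decode k x s.1 j.1 e.1 z.1, c'.decode k x s.2 j.2 e.2 z.2)
  decode_eq k w d p s := Prod.ext
    (c.decode_eq k (fun n => (w n).1) d p.1 fun k => (s k).1)
    (c'.decode_eq k (fun n => (w n).2) d p.2 fun k => (s k).2)
  exists_rerandomize k d d' h := by
    obtain ⟨f, hf, hf'⟩ := c.exists_rerandomize k d d' h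
    obtain ⟨g, hg, hg'⟩ := c'.exists_rerandomize k d d' h
    refine ⟨fun ω =>
      let a := f (fun n => (ω.1 n).1, ω.2.1.1, fun k => (ω.2.2 k).1)
      let b := g (fun n => (ω.1 n).2, ω.2.1.2, fun k => (ω.2.2 k).2)
      (fun n => (a.1 n, b.1 n), (a.2.1, b.2.1), fun k => (a.2.2 k, b.2.2 k)), ?_, fun ω => ?_⟩
    · intro ω ω' e
      simp only [Prod.mk.injEq, funext_iff] at e
      have e1 := @hf (fun n => (ω.1 n).1, ω.2.1.1, fun k => (ω.2.2 k).1)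
        (fun n => (ω'.1 n).1, ω'.2.1.1, fun k => (ω'.2.2 k).1)
        (Prod.ext (funext fun n => (e.1 n).1) (Prod.ext e.2.1.1 (funext fun k => (e.2.2 k).1)))
      have e2 := @hg (fun n => (ω.1 n).2, ω.2.1.2, fun k => (ω.2.2 k).2)
        (fun n => (ω'.1 n).2, ω'.2.1.2, fun k => (ω'.2.2 k).2)
        (Prod.ext (funext fun n => (e.1 n).2) (Prod.ext e.2.1.2 (funext fun k => (e.2.2 k).2)))
      simp only [Prod.mk.injEq, funext_iff] at e1 e2
      exact Prod.ext (funext fun n => Prod.ext (e1.1 n) (e2.1 n))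
        (Prod.ext (Prod.ext e1.2.1 e2.2.1) (funext fun k => Prod.ext (e1.2.2 k) (e2.2.2 k)))
    · obtain ⟨a1, a2, a3, a4⟩ := hf' (fun n => (ω.1 n).1, ω.2.1.1, fun k => (ω.2.2 k).1)
      obtain ⟨b1, b2, b3, b4⟩ := hg' (fun n => (ω.1 n).2, ω.2.1.2, fun k => (ω.2.2 k).2)
      exact ⟨Prod.ext a1 b1, Prod.ext a2 b2, Prod.ext a3 b3, Prod.ext a4 b4⟩

variable [Fintype S] [Nonempty S] [Fintype P] [Nonempty P] [Fintype J] {F a b : ℕ}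

/-- A uniform scheme as a scheme on bit strings, through encodings of its alphabets. -/
def toScheme (c : UniformScheme N A C E S P J) (eA : (Fin F → Bool) ≃ A) (eC : C ≃ Fin a)
    (eE : E ≃ Fin b) : Scheme N 2 F where
  S := fun _ => S
  P := P
  J := J
  cacheSize := a
  payloadSize := b
  lawS := PMF.uniformOfFintype (Fin 2 → S)
  lawP := PMF.uniformOfFintype P
  cache k s p w := eC (c.cache k s p fun n => eA (w n))
  payload w d p s := eE (c.payload (fun n => eA (w n)) d p s)
  aux d p s := c.aux d p s
  decode k x s j e z := eA.symm (c.decode k x s j (eE.symm e) (eC.symm z))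

variable (c : UniformScheme N A C E S P J) (eA : (Fin F → Bool) ≃ A) (eC : C ≃ Fin a)
    (eE : E ≃ Fin b)

lemma toScheme_isDecodable : (c.toScheme eA eC eE).IsDecodable := by
  intro k w d p _ s _
  simp only [toScheme, Equiv.symm_apply_apply]
  rw [c.decode_eq k (fun n => eA (w n)) d p s, Equiv.symm_apply_apply]

lemma viewLaw_toScheme (k : Fin 2) (d : Demands N 2) : (c.toScheme eA eC eE).viewLaw k d
    = (PMF.uniformOfFintype (Files N F × P × (Fin 2 → S))).map fun ω =>
      ((d k, ω.2.2 k, c.aux d ω.2.1 ω.2.2, eE (c.payload (fun n => eA (ω.1 n)) d ω.2.1 ω.2.2),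
        eC (c.cache k (ω.2.2 k) ω.2.1 fun n => eA (ω.1 n))) : Fin N × S × J × Fin b × Fin a) := by
  rw [← bind_uniformOfFintype_triple]
  rfl

/-- An injection of a finite set is a permutation, so the re-randomization preserves the uniform law
while it carries the view under d to that under d'. -/
lemma toScheme_isDemandPrivate [NeZero N] : (c.toScheme eA eC eE).IsDemandPrivate := by
  refine Scheme.isDemandPrivate_of_viewLaw_eq _ fun k d d' h => ?_
  obtain ⟨f, hf, hf'⟩ := c.exists_rerandomize k d d' h
  let ι : Files N F × P × (Fin 2 → S) ≃ (Fin N → A) × P × (Fin 2 → S) :=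
    (Equiv.arrowCongr (Equiv.refl _) eA).prodCongr (Equiv.refl _)
  have hinj : Function.Injective fun ω => ι.symm (f (ι ω)) :=
    ι.symm.injective.comp (hf.comp ι.injective)
  let e : Equiv.Perm (Files N F × P × (Fin 2 → S)) :=
    Equiv.ofBijective _ (Finite.injective_iff_bijective.1 hinj)
  have hι : ∀ ω, ι (e ω) = f (ι ω) := fun ω => ι.apply_symm_apply _
  have hι1 : ∀ ω, (ι ω).1 = fun n => eA (ω.1 n) := fun ω => rfl
  have hι2 : ∀ ω, (ι ω).2 = ω.2 := fun ω => rfl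
  rw [viewLaw_toScheme, viewLaw_toScheme]
  conv_rhs => rw [← map_uniformOfFintype_perm e, PMF.map_comp]
  congr 1
  funext ω
  obtain ⟨h1, h2, h3, h4⟩ := hf' (ι ω)
  rw [← hι] at h1 h2 h3 h4
  simp only [hι1, hι2] at h1 h2 h3 h4
  rw [h1] at h4
  simp only [Function.comp, h, h1, h2, h3]
  rw [h4]

end UniformScheme

/-! ### Making linear schemes private -/

section LinearAlgebra

variable {𝕜 V W : Type*} [Field 𝕜] [AddCommGroup V] [Module 𝕜 V] [FiniteDimensional 𝕜 V]
  [AddCommGroup W] [Module 𝕜 W]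

/-- Linear maps with the same range differ by an automorphism of their domain. -/
lemma exists_linearEquiv_of_range_eq {f g : V →ₗ[𝕜] W} (h : LinearMap.range f = LinearMap.range g) :
    ∃ e : V ≃ₗ[𝕜] V, ∀ v, f v = g (e v) := by
  obtain ⟨p, hp⟩ := (LinearMap.ker f).exists_isCompl
  obtain ⟨p', hp'⟩ := (LinearMap.ker g).exists_isCompl
  have hk : Module.finrank 𝕜 (LinearMap.ker f) = Module.finrank 𝕜 (LinearMap.ker g) := by
    have h1 := f.finrank_range_add_finrank_ker
    have h2 := g.finrank_range_add_finrank_ker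
    rw [h] at h1
    omega
  let a := f.kerComplementEquivRange hp.symm
  let b := g.kerComplementEquivRange hp'.symm
  -- Kernel goes to kernel, by equality of dimensions, and complement to complement through the
  -- common range.
  let e := (Submodule.prodEquivOfIsCompl _ _ hp).symm ≪≫ₗ
    (LinearEquiv.prodCongr (LinearEquiv.ofFinrankEq _ _ hk)
      (a ≪≫ₗ LinearEquiv.ofEq _ _ h ≪≫ₗ b.symm)) ≪≫ₗ Submodule.prodEquivOfIsCompl _ _ hp'
  refine ⟨e, fun v => ?_⟩
  obtain ⟨⟨x, y⟩, rfl⟩ := (Submodule.prodEquivOfIsCompl _ _ hp).surjective v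
  have hb : ∀ z, g (b.symm z) = z := fun z => congrArg Subtype.val (b.apply_symm_apply z)
  have ha : (a y : W) = f y := rfl
  simp [e, hb, ha]

end LinearAlgebra

/-- A linear demand-private scheme over `𝔽₂` with one file symbol space `A`, cache space `C` and
payload space `E`. The decoders of user `k` are determined by her demand up to automorphisms of
`A`, `C` and `E`. -/
structure LinearScheme (N : ℕ) (A C E : Type) [AddCommGroup A] [Module (ZMod 2) A]
    [AddCommGroup C] [Module (ZMod 2) C] [AddCommGroup E] [Module (ZMod 2) E] where
  /-- cache contents -/
  cache : Fin 2 → (Fin N → A) →ₗ[ZMod 2] C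
  /-- broadcast -/
  payload : Demands N 2 → (Fin N → A) →ₗ[ZMod 2] E
  /-- cache part of the decoder -/
  fromCache : Fin 2 → Demands N 2 → C →ₗ[ZMod 2] A
  /-- broadcast part of the decoder -/
  fromPayload : Fin 2 → Demands N 2 → E →ₗ[ZMod 2] A
  decode_eq : ∀ k d w, fromCache k d (cache k w) + fromPayload k d (payload d w) = w (d k)
  surjective : ∀ k d, Function.Surjective ((cache k).prod (payload d))
  exists_range_eq : ∀ k (d d' : Demands N 2), d k = d' k → ∃ τ : A ≃ₗ[ZMod 2] A,
    LinearMap.range (fromCache k d') = LinearMap.range (τ.toLinearMap ∘ₗ fromCache k d) ∧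
    LinearMap.range (fromPayload k d') = LinearMap.range (τ.toLinearMap ∘ₗ fromPayload k d)

namespace LinearScheme

variable {N : ℕ} {A C E : Type} [AddCommGroup A] [Module (ZMod 2) A]
    [AddCommGroup C] [Module (ZMod 2) C] [AddCommGroup E] [Module (ZMod 2) E]

/-- The space of decoders. -/
abbrev Decoder (A C E : Type) [AddCommGroup A] [Module (ZMod 2) A]
    [AddCommGroup C] [Module (ZMod 2) C] [AddCommGroup E] [Module (ZMod 2) E] : Type :=
  (C →ₗ[ZMod 2] A) × (E →ₗ[ZMod 2] A)

/-- The private coordinate changes. -/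
abbrev Twist (A C E : Type) [AddCommGroup A] [Module (ZMod 2) A]
    [AddCommGroup C] [Module (ZMod 2) C] [AddCommGroup E] [Module (ZMod 2) E] : Type :=
  (A ≃ₗ[ZMod 2] A) × (Fin 2 → C ≃ₗ[ZMod 2] C) × (E ≃ₗ[ZMod 2] E)

/-- The decoder of user `k` after a change of coordinates. -/
def twistedDecoder (c : LinearScheme N A C E) (k : Fin 2) (d : Demands N 2) (p : Twist A C E) :
    Decoder A C E :=
  (p.1.symm.toLinearMap ∘ₗ c.fromCache k d ∘ₗ (p.2.1 k).symm.toLinearMap,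
    p.1.symm.toLinearMap ∘ₗ c.fromPayload k d ∘ₗ p.2.2.symm.toLinearMap)

/-- Equal ranges give the automorphisms a and b matching the two decoders. Both (cache, payload)
maps are onto C × E, so they still have equal ranges after twisting one of them by a × b, which
gives σ. -/
lemma exists_equivs [Finite A] [Finite C] [Finite E] (c : LinearScheme N A C E) (k : Fin 2)
    {d d' : Demands N 2} (h : d k = d' k) :
    ∃ (τ : A ≃ₗ[ZMod 2] A) (a : C ≃ₗ[ZMod 2] C) (b : E ≃ₗ[ZMod 2] E)
      (σ : (Fin N → A) ≃ₗ[ZMod 2] (Fin N → A)),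
      (∀ z, c.fromCache k d' z = τ (c.fromCache k d (a z))) ∧
      (∀ e, c.fromPayload k d' e = τ (c.fromPayload k d (b e))) ∧
      (∀ w, c.cache k w = a (c.cache k (σ w))) ∧
      (∀ w, c.payload d w = b (c.payload d' (σ w))) := by
  obtain ⟨τ, h1, h2⟩ := c.exists_range_eq k d d' h
  obtain ⟨a, ha⟩ := exists_linearEquiv_of_range_eq h1
  obtain ⟨b, hb⟩ := exists_linearEquiv_of_range_eq h2
  have h3 : LinearMap.range ((c.cache k).prod (c.payload d))
      = LinearMap.range ((a.prodCongr b).toLinearMap ∘ₗ (c.cache k).prod (c.payload d')) := by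
    rw [LinearMap.range_eq_top.2 (c.surjective k d), eq_comm, LinearMap.range_eq_top]
    rw [LinearMap.coe_comp]
    exact (a.prodCongr b).surjective.comp (c.surjective k d')
  obtain ⟨σ, hσ⟩ := exists_linearEquiv_of_range_eq h3
  exact ⟨τ, a, b, σ, ha, hb, fun w => congrArg Prod.fst (hσ w), fun w => congrArg Prod.snd (hσ w)⟩

/-- The scheme obtained from a linear scheme by applying it to `q` symbols of each file in private
random coordinates, and sending each user her decoder encrypted with a one-time pad. -/
def toUniformScheme [Finite A] [Finite C] [Finite E] (c : LinearScheme N A C E) (q : ℕ) :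
    UniformScheme N (Fin q → A) (Fin q → C) (Fin q → E) (Decoder A C E) (Twist A C E)
      (Fin 2 → Decoder A C E) where
  cache k _ p w j := p.2.1 k (c.cache k fun n => p.1 (w n j))
  payload w d p _ j := p.2.2 (c.payload d fun n => p.1 (w n j))
  aux d p s k := s k + c.twistedDecoder k d p
  decode k _ s J e z j := (J k - s).1 (z j) + (J k - s).2 (e j)
  decode_eq k w d p s := by
    funext j
    simp only [add_sub_cancel_left, twistedDecoder, LinearMap.comp_apply, LinearEquiv.coe_coe,
      LinearEquiv.symm_apply_apply]
    rw [← map_add, c.decode_eq, LinearEquiv.symm_apply_apply]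
  exists_rerandomize k d d' h := by
    obtain ⟨τ, a, b, σ, h1, h2, h3, h4⟩ := c.exists_equivs k h
    -- Only the cache coordinates of user k move; those of the other user are invisible to her.
    let T : Twist A C E → Twist A C E := fun p =>
      (p.1 ≪≫ₗ τ, Function.update p.2.1 k (a ≪≫ₗ p.2.1 k), b ≪≫ₗ p.2.2)
    have hT : Function.Injective T := by
      intro p p' e
      simp only [T, Prod.mk.injEq] at e
      obtain ⟨e1, e2, e3⟩ := e
      refine Prod.ext ?_ (Prod.ext ?_ ?_)
      · ext x
        exact τ.injective (LinearEquiv.congr_fun e1 x)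
      · funext i
        have e4 := congrFun e2 i
        by_cases hi : i = k
        · subst hi
          simp only [Function.update_self] at e4
          ext x
          simpa using LinearEquiv.congr_fun e4 (a.symm x)
        · simpa [Function.update_of_ne hi] using e4
      · ext x
        simpa using LinearEquiv.congr_fun e3 (b.symm x)
    have hdec : ∀ p, c.twistedDecoder k d' (T p) = c.twistedDecoder k d p := by
      intro p
      refine Prod.ext (LinearMap.ext fun x => ?_) (LinearMap.ext fun x => ?_)
      · simp [twistedDecoder, T, h1]
      · simp [twistedDecoder, T, h2]
    -- Files move by σ in the secret coordinates, and the pads are shifted to keep both ciphertexts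
    -- fixed. By `hdec` the pad of user k is unchanged.
    refine ⟨fun ω => (fun n j => (T ω.2.1).1.symm (σ (fun n => ω.2.1.1 (ω.1 n j)) n), T ω.2.1,
      fun i => ω.2.2 i + c.twistedDecoder i d ω.2.1 - c.twistedDecoder i d' (T ω.2.1)), ?_, ?_⟩
    · rintro ⟨w, p, s⟩ ⟨w', p', s'⟩ e
      simp only [Prod.mk.injEq] at e
      obtain ⟨e1, e2, e3⟩ := e
      obtain rfl := hT e2
      refine Prod.ext ?_ (Prod.ext rfl ?_)
      · funext n j
        have e4 : σ (fun n => p.1 (w n j)) = σ (fun n => p.1 (w' n j)) := by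
          funext n
          exact (T p).1.symm.injective (congrFun (congrFun e1 n) j)
        exact p.1.injective (congrFun (σ.injective e4) n)
      · funext i
        have e4 := congrFun e3 i
        simpa using e4
    · rintro ⟨w, p, s⟩
      refine ⟨?_, ?_, ?_, ?_⟩
      · simp [hdec]
      · funext i
        simp
      · funext j
        simp only [LinearEquiv.apply_symm_apply]
        rw [h4]
        rfl
      · funext j
        simp only [LinearEquiv.apply_symm_apply]
        rw [h3 fun n => p.1 (w n j)]
        simp [T]

end LinearScheme

open LinearScheme

instance {V W : Type} [AddCommGroup V] [Module (ZMod 2) V] [AddCommGroup W] [Module (ZMod 2) W]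
    [Finite V] [Finite W] : Finite (V →ₗ[ZMod 2] W) :=
  Finite.of_injective _ DFunLike.coe_injective

instance {V W : Type} [AddCommGroup V] [Module (ZMod 2) V] [AddCommGroup W] [Module (ZMod 2) W]
    [Finite V] [Finite W] : Finite (V ≃ₗ[ZMod 2] W) :=
  Finite.of_injective _ DFunLike.coe_injective

lemma len_eq_of_card {A : Type} [Fintype A] {n : ℕ} (h : Fintype.card A = 2 ^ n) : len A = n := by
  rw [len, h]
  push_cast
  rw [Real.logb_pow, Real.logb_self_eq_one (by norm_num), mul_one]

lemma card_prod_fin_fun {V V' : Type} {a a' : ℕ} (h : Nat.card V = 2 ^ a) (h' : Nat.card V' = 2 ^ a')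
    (q q' : ℕ) : Nat.card ((Fin q → V) × (Fin q' → V')) = 2 ^ (a * q + a' * q') := by
  rw [Nat.card_prod, Nat.card_fun, Nat.card_fun, h, h', Nat.card_fin, Nat.card_fin, ← pow_mul,
    ← pow_mul, pow_add]

/-- Memory sharing between two linear demand-private schemes. -/
theorem achievable_of_linearSchemes {N : ℕ} [NeZero N] {A C E A' C' E' : Type}
    [AddCommGroup A] [Module (ZMod 2) A] [AddCommGroup C] [Module (ZMod 2) C]
    [AddCommGroup E] [Module (ZMod 2) E] [AddCommGroup A'] [Module (ZMod 2) A']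
    [AddCommGroup C'] [Module (ZMod 2) C'] [AddCommGroup E'] [Module (ZMod 2) E']
    [Finite A] [Finite C] [Finite E] [Finite A'] [Finite C'] [Finite E']
    (c : LinearScheme N A C E) (c' : LinearScheme N A' C' E') {l m r l' m' r' : ℕ}
    (hl : 0 < l) (hl' : 0 < l')
    (hA : Nat.card A = 2 ^ l) (hC : Nat.card C = 2 ^ m) (hE : Nat.card E = 2 ^ r)
    (hA' : Nat.card A' = 2 ^ l') (hC' : Nat.card C' = 2 ^ m') (hE' : Nat.card E' = 2 ^ r')
    {t M R : ℝ} (ht0 : 0 ≤ t) (ht1 : t ≤ 1)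
    (hM : t * (m / l) + (1 - t) * (m' / l') ≤ M) (hR : t * (r / l) + (1 - t) * (r' / l') ≤ R) :
    Achievable N 2 M R := by
  intro ε hε F₀
  let := Fintype.ofFinite (Decoder A C E)
  let := Fintype.ofFinite (Decoder A' C' E')
  let := Fintype.ofFinite (Twist A C E)
  let := Fintype.ofFinite (Twist A' C' E')
  have len_nonneg : ∀ (X : Type) [Fintype X] [Nonempty X], 0 ≤ len X := by
    intro X _ _
    exact Real.logb_nonneg (by norm_num) (by exact_mod_cast Fintype.card_pos)
  set lS := len (Decoder A C E × Decoder A' C' E') with hlS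
  set lJ := len ((Fin 2 → Decoder A C E) × (Fin 2 → Decoder A' C' E')) with hlJ
  have hS0 : 0 ≤ lS := len_nonneg _
  have hJ0 : 0 ≤ lJ := len_nonneg _
  -- The numerator collects the rounding losses m'l and r'l and the key lengths, none of which
  -- depends on n.
  obtain ⟨n₁, hn₁⟩ := exists_nat_ge ((m' * l + r' * l + lS + lJ) / ε)
  set n := n₁ + F₀ + 1 with hn
  set a := ⌊t * n⌋₊ with ha
  have htn : t * n ≤ n := mul_le_of_le_one_left (Nat.cast_nonneg n) ht1
  have han : a ≤ n := by
    exact_mod_cast (Nat.floor_le (by positivity)).trans htn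
  have ha1 : (a : ℝ) ≤ t * n := Nat.floor_le (by positivity)
  have ha2 : t * n - 1 ≤ a := (Nat.sub_one_lt_floor _).le
  -- The factors l' and l make the two shares use ll'a and ll'(n - a) bits per file, so that F =
  -- ll'n exactly.
  set q := l' * a with hq
  set q' := l * (n - a) with hq'
  have hll : 1 ≤ l * l' := Nat.mul_pos hl hl'
  have hF : l * q + l' * q' = l * l' * n := by
    rw [hq, hq']
    obtain ⟨b, hb⟩ := Nat.exists_eq_add_of_le han
    rw [hb, Nat.add_sub_cancel_left]; ring
  have hq'r : (q' : ℝ) = l * (n - a) := by rw [hq']; push_cast [Nat.cast_sub han]; ring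
  have hqr : (q : ℝ) = l' * a := by rw [hq]; push_cast; ring
  set F := l * l' * n with hFdef
  have hnF : n ≤ F := Nat.le_mul_of_pos_left n hll
  have hnFr : (n : ℝ) ≤ F := by exact_mod_cast hnF
  have hεn : m' * l + r' * l + lS + lJ ≤ ε * F := by
    rw [div_le_iff₀ hε] at hn₁
    have : (n₁ : ℝ) ≤ n := by exact_mod_cast (by omega : n₁ ≤ n)
    nlinarith
  have hlr : (0 : ℝ) < l := by exact_mod_cast hl
  have hlr' : (0 : ℝ) < l' := by exact_mod_cast hl'
  have hsize : ∀ (x x' : ℕ) (X : ℝ), t * (x / l) + (1 - t) * (x' / l') ≤ X →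
      (((x * q + x' * q' : ℕ)) : ℝ) ≤ X * F + x' * l := by
    intro x x' X hX
    have e1 : (t * (x / l) + (1 - t) * (x' / l')) * F
        = x * (l' * (t * n)) + x' * (l * (n - t * n)) := by
      rw [hFdef]; push_cast; field_simp
    have e2 := mul_le_mul_of_nonneg_right hX (Nat.cast_nonneg (α := ℝ) F)
    rw [e1] at e2
    push_cast
    rw [hqr, hq'r]
    have e3 : (x : ℝ) * (l' * a) ≤ x * (l' * (t * n)) := by gcongr
    have e4 : (x' : ℝ) * (l * (n - a)) ≤ x' * (l * (n - (t * n - 1))) := by gcongr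
    linarith
  let C₀ := (c.toUniformScheme q).prod (c'.toUniformScheme q')
  have cA := card_prod_fin_fun hA hA' q q'
  have cC := card_prod_fin_fun hC hC' q q'
  have cE := card_prod_fin_fun hE hE' q q'
  rw [hF] at cA
  let eA : (Fin F → Bool) ≃ (Fin q → A) × (Fin q' → A') :=
    (Finite.equivFinOfCardEq (by rw [Nat.card_fun]; simp)).trans (Finite.equivFinOfCardEq cA).symm
  let eC := Finite.equivFinOfCardEq cC
  let eE := Finite.equivFinOfCardEq cE
  have hml : 0 ≤ (m' : ℝ) * l := by positivity
  have hrl : 0 ≤ (r' : ℝ) * l := by positivity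
  refine ⟨F, by omega, C₀.toScheme eA eC eE, C₀.toScheme_isDecodable eA eC eE,
    C₀.toScheme_isDemandPrivate eA eC eE, ?_, ?_, fun k => ?_, ?_⟩
  · change len (Fin (2 ^ (m * q + m' * q'))) ≤ _
    rw [len_eq_of_card (Fintype.card_fin _)]
    linarith [hsize m m' M hM]
  · change len (Fin (2 ^ (r * q + r' * q'))) ≤ _
    rw [len_eq_of_card (Fintype.card_fin _)]
    linarith [hsize r r' R hR]
  · change lS ≤ _
    linarith
  · change lJ ≤ _
    linarith

/-! ### Linear schemes for the corner points -/

namespace LinearScheme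

variable {N : ℕ}

/-- Every user caches the whole library. -/
def cacheAll (N : ℕ) : LinearScheme N (ZMod 2) (Fin N → ZMod 2) PUnit where
  cache _ := LinearMap.id
  payload _ := 0
  fromCache k d := LinearMap.proj (d k)
  fromPayload _ _ := 0
  decode_eq k d w := by simp
  surjective k d z := ⟨z.1, rfl⟩
  exists_range_eq k d d' h := ⟨LinearEquiv.refl _ _, by rw [h]; rfl, rfl⟩

section SecondFile

variable [Nontrivial (Fin N)]

/-- A file different from the one demanded by user `0`: the other demanded file, if there is
one. -/
def secondFile (d : Demands N 2) : Fin N :=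
  if d 1 = d 0 then (exists_ne (d 0)).choose else d 1

lemma secondFile_ne (d : Demands N 2) : secondFile d ≠ d 0 := by
  unfold secondFile
  split_ifs with h
  · exact (exists_ne (d 0)).choose_spec
  · exact h

lemma secondFile_eq {d : Demands N 2} (h : d 1 ≠ d 0) : secondFile d = d 1 := if_neg h

variable (N) in
/-- Nothing is cached, and two distinct files, including all demanded ones, are sent. -/
def sendTwo : LinearScheme N (ZMod 2) PUnit (ZMod 2 × ZMod 2) where
  cache _ := 0
  payload d := (LinearMap.proj (d 0)).prod (LinearMap.proj (secondFile d))
  fromCache _ _ := 0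
  fromPayload k d := if k = 1 ∧ d 1 ≠ d 0 then LinearMap.snd _ _ _ else LinearMap.fst _ _ _
  decode_eq k d w := by
    fin_cases k
    · simp
    · by_cases h : d 1 = d 0
      · simp [h]
      · simp [h, secondFile_eq h]
  surjective k d z := by
    refine ⟨Function.update (fun _ => z.2.2) (d 0) z.2.1, ?_⟩
    ext <;> simp [secondFile_ne]
  exists_range_eq k d d' h := by
    refine ⟨LinearEquiv.refl _ _, by simp, ?_⟩
    have key : ∀ d : Demands N 2, LinearMap.range (if k = 1 ∧ d 1 ≠ d 0 then
        LinearMap.snd (ZMod 2) (ZMod 2) (ZMod 2) else LinearMap.fst _ _ _) = ⊤ := by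
      intro d
      split_ifs
      · exact LinearMap.range_eq_top.2 LinearMap.snd_surjective
      · exact LinearMap.range_eq_top.2 LinearMap.fst_surjective
    rw [key]
    exact (key d).symm

variable (N) in
/-- Files consist of symbols `a`, `b`, `c`; user `0` caches all `a`'s and user `1` all `b`'s, and
three symbols are sent. -/
def thirds :
    LinearScheme N (ZMod 2 × ZMod 2 × ZMod 2) (Fin N → ZMod 2) (ZMod 2 × ZMod 2 × ZMod 2) where
  cache k :=
    { toFun := fun w n => if k = 0 then (w n).1 else (w n).2.1
      map_add' := fun w w' => by ext n; simp only [Pi.add_apply]; split_ifs <;> simp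
      map_smul' := fun t w => by ext n; simp only [Pi.smul_apply]; split_ifs <;> simp }
  payload d :=
    -- For equal demands the third symbol is a mirror image of the first one: user 1 recovers her
    -- missing symbol a from it, and both users read c from the second.
    { toFun := fun w => ((w (d 0)).2.1 + (w (secondFile d)).1, (w (d 0)).2.2,
        if d 1 = d 0 then (w (d 0)).1 + (w (secondFile d)).2.1 else (w (secondFile d)).2.2)
      map_add' := fun w w' => by
        ext
        · simp; ring
        · simp
        · simp only [Pi.add_apply, Prod.snd_add, Prod.fst_add]; split_ifs <;> ring
      map_smul' := fun t w => by
        ext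
        · simp; ring
        · simp
        · simp only [Pi.smul_apply, Prod.smul_snd, Prod.smul_fst, smul_eq_mul, RingHom.id_apply]
          split_ifs <;> ring }
  fromCache k d :=
    { toFun := fun z => if k = 0 then (z (d 0), -z (secondFile d), 0) else
        if d 1 = d 0 then (-z (secondFile d), z (d 0), 0) else (-z (d 0), z (secondFile d), 0)
      map_add' := fun w w' => by split_ifs <;> ext <;> simp <;> ring
      map_smul' := fun t w => by split_ifs <;> ext <;> simp }
  fromPayload k d :=
    { toFun := fun e => if k = 0 then (0, e.1, e.2.1) else
        if d 1 = d 0 then (e.2.2, 0, e.2.1) else (e.1, 0, e.2.2)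
      map_add' := fun w w' => by split_ifs <;> ext <;> simp
      map_smul' := fun t w => by split_ifs <;> ext <;> simp }
  decode_eq k d w := by
    fin_cases k
    · ext <;> simp [-ZMod.neg_eq_self_mod_two]
    · by_cases h : d 1 = d 0
      · ext <;> simp [-ZMod.neg_eq_self_mod_two, h]
      · ext <;> simp [-ZMod.neg_eq_self_mod_two, h, secondFile_eq h]
  surjective k d z := by
    obtain ⟨z, e₁, e₂, e₃⟩ := z
    have hs := secondFile_ne d
    by_cases hk : k = 0
    · by_cases h : d 1 = d 0
      · refine ⟨fun n => (z n, if n = d 0 then e₁ - z (secondFile d) else e₃ - z (d 0), e₂), ?_⟩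
        ext <;> simp [hk, h, hs]
      · refine ⟨fun n => (z n, e₁ - z (secondFile d), if n = d 0 then e₂ else e₃), ?_⟩
        ext <;> simp [hk, h, hs]
    · by_cases h : d 1 = d 0
      · refine ⟨fun n => (if n = d 0 then e₃ - z (secondFile d) else e₁ - z (d 0), z n, e₂), ?_⟩
        ext <;> simp [hk, h, hs]
      · refine ⟨fun n => (e₁ - z (d 0), z n, if n = d 0 then e₂ else e₃), ?_⟩
        ext <;> simp [hk, h, hs]
  exists_range_eq k d d' h := by
    -- The cache half of a decoder fills the a and b coordinates, the payload half fills all but the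
    -- cached coordinate; neither depends on whether the demands agree.
    refine ⟨LinearEquiv.refl _ _, ?_, ?_⟩
    · suffices key : ∀ (d : Demands N 2) (x : ZMod 2 × ZMod 2 × ZMod 2), (∃ z : Fin N → ZMod 2,
          (if k = 0 then (z (d 0), -z (secondFile d), 0) else
          if d 1 = d 0 then (-z (secondFile d), z (d 0), 0) else (-z (d 0), z (secondFile d), 0))
            = x) ↔ x.2.2 = 0 by
        ext x
        exact (key d' x).trans (key d x).symm
      intro d x
      have hs := secondFile_ne d
      constructor
      · rintro ⟨z, rfl⟩
        split_ifs <;> rfl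
      · obtain ⟨a, b, c⟩ := x
        rintro rfl
        split_ifs
        · exact ⟨Function.update (fun _ => -b) (d 0) a, by simp [hs]⟩
        · exact ⟨Function.update (fun _ => -a) (d 0) b, by simp [hs]⟩
        · exact ⟨Function.update (fun _ => b) (d 0) (-a), by simp [hs]⟩
    · suffices key : ∀ (d : Demands N 2) (x : ZMod 2 × ZMod 2 × ZMod 2),
          (∃ e : ZMod 2 × ZMod 2 × ZMod 2, (if k = 0 then (0, e.1, e.2.1) else
          if d 1 = d 0 then (e.2.2, 0, e.2.1) else (e.1, 0, e.2.2)) = x)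
            ↔ if k = 0 then x.1 = 0 else x.2.1 = 0 by
        ext x
        exact (key d' x).trans (key d x).symm
      rintro d ⟨a, b, c⟩
      split_ifs
      · exact ⟨by rintro ⟨e, h⟩; simp_all, fun h => ⟨(b, c, 0), by simp_all⟩⟩
      · exact ⟨by rintro ⟨e, h⟩; simp_all, fun h => ⟨(0, c, a), by simp_all⟩⟩
      · exact ⟨by rintro ⟨e, h⟩; simp_all, fun h => ⟨(a, 0, c), by simp_all⟩⟩

end SecondFile

lemma eq_add_one_of_ne : ∀ {j k : Fin 2}, j ≠ k → j = k + 1 := by decide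

/-- Each of the `n + 1` files has a part of `n` symbols for either user and a common symbol. User
`k` caches her part and the common symbol of every file; the sum of the missing parts is sent,
masked by the common symbols of the other files if the two demands agree. -/
def partsAndCommon (n : ℕ) : LinearScheme (n + 1) ((Fin 2 → Fin n → ZMod 2) × ZMod 2)
    (Fin (n + 1) → (Fin n → ZMod 2) × ZMod 2) (Fin n → ZMod 2) where
  cache k :=
    { toFun := fun w m => ((w m).1 k, (w m).2)
      map_add' := fun w w' => rfl
      map_smul' := fun t w => rfl }
  payload d :=
    { toFun := fun w i => (w (d 0)).1 1 i + (w (d 1)).1 0 i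
        + if d 1 = d 0 then (w ((d 0).succAbove i)).2 else 0
      map_add' := fun w w' => by
        ext i; simp only [Pi.add_apply, Prod.fst_add, Prod.snd_add]; split_ifs <;> ring
      map_smul' := fun t w => by
        ext i
        simp only [Pi.smul_apply, Prod.smul_fst, Prod.smul_snd, smul_eq_mul, RingHom.id_apply]
        split_ifs <;> ring }
  fromCache k d :=
    { toFun := fun z => (fun j i => if j = k then (z (d k)).1 i else
        -((z (d (k + 1))).1 i + if d 1 = d 0 then (z ((d 0).succAbove i)).2 else 0), (z (d k)).2)
      map_add' := fun w w' => by
        ext i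
        · simp only [Pi.add_apply, Prod.fst_add, Prod.snd_add]; split_ifs <;> ring
        · simp
      map_smul' := fun t w => by
        ext i
        · simp only [Pi.smul_apply, Prod.smul_fst, Prod.smul_snd, smul_eq_mul, RingHom.id_apply]
          split_ifs <;> ring
        · simp }
  fromPayload k d :=
    { toFun := fun e => (fun j i => if j = k then 0 else e i, 0)
      map_add' := fun w w' => by
        ext i
        · simp only [Pi.add_apply, Prod.mk_add_mk]; split_ifs <;> ring
        · simp
      map_smul' := fun t w => by
        ext i
        · simp only [Pi.smul_apply, Prod.smul_mk, smul_eq_mul, RingHom.id_apply]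
          split_ifs <;> ring
        · simp }
  decode_eq k d w := by
    ext j i
    · fin_cases k <;> fin_cases j <;> simp [-ZMod.neg_eq_self_mod_two] <;> ring
    · simp
  surjective k d z := by
    obtain ⟨z, e⟩ := z
    refine ⟨fun m => (fun j i => if j = k then (z m).1 i else
      e i - ((z (d (k + 1))).1 i + if d 1 = d 0 then (z ((d 0).succAbove i)).2 else 0),
      (z m).2), ?_⟩
    ext m i
    · simp
    · simp
    · fin_cases k <;> simp <;> ring
  exists_range_eq k d d' h := by
    -- For equal demands without the mask, the missing part would use minus the user's own cached
    -- part and the range would shrink. The n common symbols of the other n files restore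
    -- surjectivity.
    refine ⟨LinearEquiv.refl _ _, ?_, rfl⟩
    suffices key : ∀ d : Demands (n + 1) 2, Function.Surjective
        fun z : Fin (n + 1) → (Fin n → ZMod 2) × ZMod 2 =>
        ((fun j i => if j = k then (z (d k)).1 i else
        -((z (d (k + 1))).1 i + if d 1 = d 0 then (z ((d 0).succAbove i)).2 else 0), (z (d k)).2) :
        (Fin 2 → Fin n → ZMod 2) × ZMod 2) from
      (LinearMap.range_eq_top.2 (key d')).trans (LinearMap.range_eq_top.2 (key d)).symm
    rintro d ⟨x, u⟩
    by_cases hd : d 1 = d 0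
    · refine ⟨(d 0).insertNth (x k, u) fun i => (0, -x (k + 1) i - x k i), ?_⟩
      have hd' : ∀ i, d i = d 0 := fun i => by fin_cases i <;> simp [hd]
      ext j i
      · simp only [hd', if_true, Fin.insertNth_apply_same, Fin.insertNth_apply_succAbove]
        split_ifs with hj
        · rw [hj]
        · have := eq_add_one_of_ne hj
          rw [this]; ring
      · simp [hd']
    · have hne : d (k + 1) ≠ d k := by
        fin_cases k
        · exact hd
        · exact Ne.symm hd
      refine ⟨Function.update (fun _ => (-x (k + 1), 0)) (d k) (x k, u), ?_⟩
      ext j i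
      · simp only [hd, if_false, Function.update_self, Function.update_of_ne hne]
        split_ifs with hj
        · rw [hj]
        · have := eq_add_one_of_ne hj
          rw [this]; simp
      · simp

end LinearScheme

namespace LinearScheme

/-- The automorphism of `𝔽₂³` adding the first coordinate to the second one if `k = 0`,
and the second one to the first one otherwise. -/
def shear (k : Fin 2) : (ZMod 2 × ZMod 2 × ZMod 2) ≃ₗ[ZMod 2] (ZMod 2 × ZMod 2 × ZMod 2) :=
  LinearEquiv.ofInvolutive
    { toFun := fun x => if k = 0 then (x.1, x.2.1 + x.1, x.2.2) else (x.1 + x.2.1, x.2.1, x.2.2)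
      map_add' := fun x y => by split_ifs <;> ext <;> simp <;> ring
      map_smul' := fun t x => by split_ifs <;> ext <;> simp <;> ring } <| by
    intro x
    by_cases h : k = 0 <;> simp [h, add_assoc, CharTwo.add_self_eq_zero]

/-- Two files of three symbols; user `k` caches the sum of the `k`-th symbols of both files, and
four symbols are sent. -/
def codedCache : LinearScheme 2 (ZMod 2 × ZMod 2 × ZMod 2) (ZMod 2)
    (ZMod 2 × ZMod 2 × ZMod 2 × ZMod 2) where
  cache k :=
    { toFun := fun w => if k = 0 then (w 0).1 + (w 1).1 else (w 0).2.1 + (w 1).2.1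
      map_add' := fun w w' => by split_ifs <;> simp <;> ring
      map_smul' := fun t w => by split_ifs <;> simp <;> ring }
  payload d :=
    { toFun := fun w => if d 1 = d 0 then
          ((w (d 0)).1 - (w (d 0)).2.1, (w (d 0)).2.2, (w (d 0 + 1)).1, (w (d 0 + 1)).2.1)
        else ((w (d 0)).2.1, (w (d 0)).2.2, (w (d 0 + 1)).1, (w (d 0 + 1)).2.2)
      map_add' := fun w w' => by split_ifs <;> ext <;> simp; ring
      map_smul' := fun t w => by split_ifs <;> ext <;> simp <;> ring }
  fromCache k d :=
    { toFun := fun u => if d 1 = d 0 then (u, u, 0) else if k = 0 then (u, 0, 0) else (0, u, 0)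
      map_add' := fun w w' => by split_ifs <;> ext <;> simp
      map_smul' := fun t w => by split_ifs <;> ext <;> simp }
  fromPayload k d :=
    { toFun := fun e => if d 1 = d 0 then
          if k = 0 then (-e.2.2.1, -e.2.2.1 - e.1, e.2.1) else (e.1 - e.2.2.2, -e.2.2.2, e.2.1)
        else if k = 0 then (-e.2.2.1, e.1, e.2.1) else (e.2.2.1, -e.1, e.2.2.2)
      map_add' := fun w w' => by split_ifs <;> ext <;> simp <;> ring
      map_smul' := fun t w => by split_ifs <;> ext <;> simp <;> ring }
  decode_eq k d w := by
    have hsum : ∀ (f : Fin 2 → ZMod 2) (i : Fin 2), f 0 + f 1 = f i + f (i + 1) := by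
      intro f i
      fin_cases i
      · rfl
      · exact add_comm _ _
    have h1 := hsum (fun n => (w n).1) (d 0)
    have h2 := hsum (fun n => (w n).2.1) (d 0)
    by_cases h : d 1 = d 0
    · fin_cases k
      · ext <;> simp [-ZMod.neg_eq_self_mod_two, h, h1] <;> ring
      · ext <;> simp [-ZMod.neg_eq_self_mod_two, h, h2]
    · fin_cases k
      · ext <;> simp [-ZMod.neg_eq_self_mod_two, h, h1]
      · ext <;> simp [-ZMod.neg_eq_self_mod_two, eq_add_one_of_ne h, h2]
  surjective k d z := by
    obtain ⟨u, e₁, e₂, e₃, e₄⟩ := z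
    have hcases : ∀ f : Fin 2, f = 0 ∨ f = 1 := by decide
    generalize hf : d 0 = f
    by_cases h : d 1 = f
    · by_cases hk : k = 0
      · refine ⟨Function.update (fun _ => (e₃, e₄, 0)) f (u - e₃, u - e₃ - e₁, e₂), ?_⟩
        rcases hcases f with rfl | rfl <;> ext <;> simp [hk, h]
      · refine ⟨Function.update (fun _ => (e₃, e₄, 0)) f (u - e₄ + e₁, u - e₄, e₂), ?_⟩
        rcases hcases f with rfl | rfl <;> ext <;> simp [hk, h]
    · by_cases hk : k = 0
      · refine ⟨Function.update (fun _ => (e₃, 0, e₄)) f (u - e₃, e₁, e₂), ?_⟩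
        rcases hcases f with rfl | rfl <;> ext <;> simp [hk, h]
      · refine ⟨Function.update (fun _ => (e₃, u - e₁, e₄)) f (0, e₁, e₂), ?_⟩
        rcases hcases f with rfl | rfl <;> ext <;> simp [hk, h]
  exists_range_eq k d d' h := by
    have htop : ∀ d : Demands 2 2, Function.Surjective
        fun e : ZMod 2 × ZMod 2 × ZMod 2 × ZMod 2 => (if d 1 = d 0 then
          if k = 0 then (-e.2.2.1, -e.2.2.1 - e.1, e.2.1) else (e.1 - e.2.2.2, -e.2.2.2, e.2.1)
        else if k = 0 then (-e.2.2.1, e.1, e.2.1) else (e.2.2.1, -e.1, e.2.2.2) :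
        ZMod 2 × ZMod 2 × ZMod 2) := by
      rintro d ⟨x, y, z⟩
      split_ifs
      · exact ⟨(x - y, z, -x, 0), by simp⟩
      · exact ⟨(x - y, z, 0, -y), by simp [-ZMod.neg_eq_self_mod_two]⟩
      · exact ⟨(y, z, -x, 0), by simp⟩
      · exact ⟨(-y, 0, x, z), by simp⟩
    -- The cache half has a line as range: spanned by (1, 1, 0) for equal demands, a coordinate axis
    -- otherwise. The involution `shear k` exchanges the two.
    have hτ : ∃ τ : (ZMod 2 × ZMod 2 × ZMod 2) ≃ₗ[ZMod 2] (ZMod 2 × ZMod 2 × ZMod 2), ∀ u : ZMod 2,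
        (if d' 1 = d' 0 then (u, u, 0) else if k = 0 then (u, 0, 0) else (0, u, 0))
        = τ (if d 1 = d 0 then (u, u, 0) else if k = 0 then (u, 0, 0) else (0, u, 0)) := by
      by_cases h1 : d 1 = d 0 <;> by_cases h2 : d' 1 = d' 0
      · exact ⟨LinearEquiv.refl _ _, fun u => by simp [h1, h2]⟩
      · refine ⟨shear k, fun u => ?_⟩
        by_cases hk : k = 0 <;> simp [h1, h2, hk, shear, CharTwo.add_self_eq_zero]
      · refine ⟨shear k, fun u => ?_⟩
        by_cases hk : k = 0 <;> simp [h1, h2, hk, shear]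
      · exact ⟨LinearEquiv.refl _ _, fun u => by simp [h1, h2]⟩
    obtain ⟨τ, hτ⟩ := hτ
    refine ⟨τ, congrArg LinearMap.range (LinearMap.ext hτ), ?_⟩
    refine (LinearMap.range_eq_top.2 (htop d')).trans (LinearMap.range_eq_top.2 ?_).symm
    rw [LinearMap.coe_comp]
    exact τ.surjective.comp (htop d)

end LinearScheme

/-! ### The achievable regions -/

/-- Memory sharing, in terms of the memory-rate pairs `(x, y)` and `(x', y')` of the schemes. -/
lemma achievable_of_mem_segment {N : ℕ} [NeZero N] {A C E A' C' E' : Type}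
    [AddCommGroup A] [Module (ZMod 2) A] [AddCommGroup C] [Module (ZMod 2) C]
    [AddCommGroup E] [Module (ZMod 2) E] [AddCommGroup A'] [Module (ZMod 2) A']
    [AddCommGroup C'] [Module (ZMod 2) C'] [AddCommGroup E'] [Module (ZMod 2) E']
    [Finite A] [Finite C] [Finite E] [Finite A'] [Finite C'] [Finite E']
    (c : LinearScheme N A C E) (c' : LinearScheme N A' C' E') {l m r l' m' r' : ℕ}
    (hl : 0 < l) (hl' : 0 < l')
    (hA : Nat.card A = 2 ^ l) (hC : Nat.card C = 2 ^ m) (hE : Nat.card E = 2 ^ r)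
    (hA' : Nat.card A' = 2 ^ l') (hC' : Nat.card C' = 2 ^ m') (hE' : Nat.card E' = 2 ^ r')
    {x y x' y' M R : ℝ} (hx : (m : ℝ) / l = x) (hy : (r : ℝ) / l = y) (hx' : (m' : ℝ) / l' = x')
    (hy' : (r' : ℝ) / l' = y') (hlt : x < x') (h1 : x ≤ M) (h2 : M ≤ x')
    (hR : (x' - M) * y + (M - x) * y' ≤ R * (x' - x)) :
    Achievable N 2 M R := by
  have h0 : 0 < x' - x := sub_pos.2 hlt
  refine achievable_of_linearSchemes c c' hl hl' hA hC hE hA' hC' hE'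
    (t := (x' - M) / (x' - x)) (div_nonneg (by linarith) h0.le)
    ((div_le_one h0).2 (by linarith)) (le_of_eq ?_) ?_
  · rw [hx, hx']
    field_simp
    ring
  · rw [hy, hy']
    have e : (x' - M) / (x' - x) * y + (1 - (x' - M) / (x' - x)) * y'
        = ((x' - M) * y + (M - x) * y') / (x' - x) := by
      field_simp
      ring
    rw [e, div_le_iff₀ h0]
    exact hR

lemma achievable_cacheAll {N : ℕ} [NeZero N] {M R : ℝ} (hM : N ≤ M) (hR : 0 ≤ R) :
    Achievable N 2 M R :=
  achievable_of_linearSchemes (cacheAll N) (cacheAll N) (l := 1) (m := N) (r := 0) (l' := 1)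
    (m' := N) (r' := 0) one_pos one_pos (by simp) (by simp) (by simp) (by simp) (by simp)
    (by simp) (t := 1) zero_le_one le_rfl (by simpa using hM) (by simpa using hR)

/-- The corners are (0, 2), (1/3, 4/3), (4/3, 1/3) and (2, 0), and each inequality is tight on one
segment between neighbours. -/
lemma achievable_two_two {M R : ℝ} (hM : 0 ≤ M) (hR : 0 ≤ R) (h1 : 2 * M + R ≥ 2)
    (h2 : 3 * M + 3 * R ≥ 5) (h3 : M + 2 * R ≥ 2) : Achievable 2 2 M R := by
  rcases le_total M (1 / 3) with hM1 | hM1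
  · refine achievable_of_mem_segment (sendTwo 2) codedCache (l := 1) (m := 0) (r := 2) (l' := 3)
      (m' := 1) (r' := 4) (x := 0) (y := 2) (x' := 1 / 3) (y' := 4 / 3) one_pos three_pos
      (by simp) (by simp) (by simp) (by simp) (by simp) (by simp) (by simp) (by simp) (by simp)
      (by simp) (by norm_num) hM hM1 ?_
    linarith
  rcases le_total M (4 / 3) with hM2 | hM2
  · refine achievable_of_mem_segment codedCache (partsAndCommon 1) (l := 3) (m := 1) (r := 4)
      (l' := 3) (m' := 4) (r' := 1) (x := 1 / 3) (y := 4 / 3) (x' := 4 / 3) (y' := 1 / 3)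
      three_pos three_pos (by simp) (by simp) (by simp) (by simp) (by simp) (by simp) (by simp)
      (by simp) (by simp) (by simp) (by norm_num) hM1 hM2 ?_
    linarith
  rcases le_total M 2 with hM3 | hM3
  · refine achievable_of_mem_segment (partsAndCommon 1) (cacheAll 2) (l := 3) (m := 4) (r := 1)
      (l' := 1) (m' := 2) (r' := 0) (x := 4 / 3) (y := 1 / 3) (x' := 2) (y' := 0)
      three_pos one_pos (by simp) (by simp) (by simp) (by simp) (by simp) (by simp) (by simp)
      (by simp) (by simp) (by simp) (by norm_num) hM2 hM3 ?_
    linarith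
  · exact achievable_cacheAll (by simpa using hM3) hR

/-- The corners are (0, 2), (N/3, 1), (N²/(2N-1), (N-1)/(2N-1)) and (N, 0); below, n = N - 1. -/
lemma achievable_two_users {N : ℕ} [NeZero N] (hN : 2 < N) {M R : ℝ} (hM : 0 ≤ M) (hR : 0 ≤ R)
    (h1 : 3 * M + N * R ≥ 2 * N) (h2 : 3 * M + (N + 1) * R ≥ 2 * N + 1) (h3 : M + N * R ≥ N) :
    Achievable N 2 M R := by
  obtain ⟨n, rfl⟩ := Nat.exists_eq_add_of_le' (show 1 ≤ N by omega)
  have hn : 2 ≤ n := by omega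
  have hnr : (2 : ℝ) ≤ n := by exact_mod_cast hn
  have : Nontrivial (Fin (n + 1)) := Fin.nontrivial_iff_two_le.2 (by omega)
  have cardA : Nat.card ((Fin 2 → Fin n → ZMod 2) × ZMod 2) = 2 ^ (2 * n + 1) := by
    simp; ring
  have cardC : Nat.card (Fin (n + 1) → (Fin n → ZMod 2) × ZMod 2) = 2 ^ ((n + 1) ^ 2) := by
    simp; ring
  have cardE : Nat.card (Fin n → ZMod 2) = 2 ^ n := by simp
  have x2 : (((n + 1) ^ 2 : ℕ) : ℝ) / ((2 * n + 1 : ℕ) : ℝ) = (n + 1) ^ 2 / (2 * n + 1) := by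
    push_cast; rfl
  have y2 : (n : ℝ) / ((2 * n + 1 : ℕ) : ℝ) = n / (2 * n + 1) := by
    push_cast; rfl
  have h0 : (0 : ℝ) < 2 * n + 1 := by positivity
  push_cast at h1 h2 h3
  rcases le_total M ((n + 1) / 3) with hM1 | hM1
  · refine achievable_of_mem_segment (sendTwo (n + 1)) (thirds (n + 1)) (l := 1) (m := 0) (r := 2)
      (l' := 3) (m' := n + 1) (r' := 3) (x := 0) (y := 2) (x' := (n + 1) / 3) (y' := 1) one_pos
      three_pos (by simp) (by simp) (by simp) (by simp) (by simp) (by simp) (by simp) (by simp)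
      (by simp) (by simp) (by positivity) hM hM1 ?_
    nlinarith
  rcases le_total M ((n + 1) ^ 2 / (2 * n + 1)) with hM2 | hM2
  · refine achievable_of_mem_segment (thirds (n + 1)) (partsAndCommon n) (l := 3) (m := n + 1)
      (r := 3) (l' := 2 * n + 1) (m' := (n + 1) ^ 2) (r' := n) (x := (n + 1) / 3) (y := 1)
      three_pos (by omega) (by simp) (by simp) (by simp) cardA cardC cardE (by simp) (by simp) x2
      y2 ?_ hM1 hM2 ?_
    · rw [div_lt_div_iff₀ three_pos h0]
      nlinarith
    · rw [← sub_nonneg]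
      -- The distance above the segment is a positive multiple of the slack in the inequality that
      -- is tight on it.
      have e : R * ((n + 1) ^ 2 / (2 * n + 1) - (n + 1) / 3) - (((n + 1) ^ 2 / (2 * n + 1) - M) * 1
          + (M - (n + 1) / 3) * (n / (2 * n + 1)))
          = (n + 1) / (3 * (2 * n + 1)) * (3 * M + (n + 1 + 1) * R - (2 * (n + 1) + 1)) := by
        field_simp
        ring
      rw [e]
      exact mul_nonneg (by positivity) (by linarith)
  rcases le_total M (n + 1) with hM3 | hM3
  · refine achievable_of_mem_segment (partsAndCommon n) (cacheAll (n + 1)) (l := 2 * n + 1)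
      (m := (n + 1) ^ 2) (r := n) (l' := 1) (m' := n + 1) (r' := 0) (x' := n + 1) (y' := 0)
      (by omega) one_pos cardA cardC cardE (by simp) (by simp) (by simp) x2 y2 (by simp) (by simp)
      ?_ hM2 hM3 ?_
    · rw [div_lt_iff₀ h0]
      nlinarith
    · rw [← sub_nonneg]
      have e : R * (n + 1 - (n + 1) ^ 2 / (2 * n + 1)) - ((n + 1 - M) * (n / (2 * n + 1))
          + (M - (n + 1) ^ 2 / (2 * n + 1)) * 0)
          = n / (2 * n + 1) * (M + (n + 1) * R - (n + 1)) := by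
        field_simp
        ring
      rw [e]
      exact mul_nonneg (by positivity) (by linarith)
  · exact achievable_cacheAll (by push_cast; exact hM3) hR

end CodedCaching

end

theorem theorem6 :
    (∀ M R : ℝ, 0 ≤ M → 0 ≤ R →
      (CodedCaching.Achievable 2 2 M R ↔
        2 * M + R ≥ 2 ∧ 3 * M + 3 * R ≥ 5 ∧ M + 2 * R ≥ 2)) ∧
    (∀ (N : ℕ) [NeZero N], 2 < N → ∀ M R : ℝ, 0 ≤ M → 0 ≤ R →
      (CodedCaching.Achievable N 2 M R ↔
        3 * M + N * R ≥ 2 * N ∧ 3 * M + (N + 1) * R ≥ 2 * N + 1 ∧ M + N * R ≥ N)) := by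
  refine ⟨fun M R hM hR => ⟨fun h => ⟨?_, ?_, ?_⟩, fun h =>
      CodedCaching.achievable_two_two hM hR h.1 h.2.1 h.2.2⟩,
    fun N _ hN M R hM hR => ⟨fun h => ⟨?_, ?_, ?_⟩, fun h =>
      CodedCaching.achievable_two_users hN hM hR h.1 h.2.1 h.2.2⟩⟩
  · have := h.bound (a := 2) (b := 1) (e := 2) (by norm_num) (by norm_num)
      fun F c m r hc _ hm hr => by linarith [hc.two_file_bound hm hr]
    linarith
  · have := h.bound (a := 3) (b := 3) (e := 5) (by norm_num) (by norm_num)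
      fun F c m r hc hp hm hr => by
        have := hc.private_bound hp le_rfl hm hr
        push_cast at this
        linarith
    linarith
  · have := h.bound (a := 1) (b := 2) (e := 2) (by norm_num) (by norm_num)
      fun F c m r hc _ hm hr => by
        have := hc.single_user_bound hm hr
        push_cast at this
        linarith
    linarith
  · exact h.bound (by norm_num) (by positivity)
      fun F c m r hc _ hm hr => hc.two_user_bound hN hm hr
  · exact h.bound (by norm_num) (by positivity)
      fun F c m r hc hp hm hr => hc.private_bound hp hN.le hm hr
  · have := h.bound (a := 1) (b := N) (e := N) (by norm_num) (by positivity)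
      fun F c m r hc _ hm hr => by linarith [hc.single_user_bound hm hr]
    linarith
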